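/- Identify the circle $S^1$ with $\mathbb{R}/\mathbb{Z}$. The primary arc of an interval $[a,b]$ of the circle (going counterclockwise from $a$ to $b$) is the chord of the closed unit disk joining the two interior points that divide $[a,b]$ into three pieces with lengths in the ratio $1:2:1$. An arc diagram is a finite collection of chords obtained as follows: start with the two arcs $\{1/3,2/3\}$ and $\{1/6,5/6\}$, which divide the circle into the four intervals $[1/6,1/3]$, $[1/3,2/3]$, $[2/3,5/6]$, $[5/6,7/6]$; then, finitely many times (possibly zero), choose one of the intervals into which the circle is currently divided and add its primary arc, which divides this interval into three. The arcs and the resulting intervals of the circle make the closed disk into a $2$-complex; two arc diagrams are isomorphic if there is an orientation-preserving isomorphism between these complexes. A dyadic rearrangement of the Basilica is a homeomorphism $f\colon S^1\to S^1$ for which there is an isomorphism $\varphi\colon\mathcal{D}\to\mathcal{R}$ of arc diagrams such that $f$ maps each interval of $\mathcal{D}$ linearly, preserving orientation, onto the corresponding interval of $\mathcal{R}$. Let $T_B$ be the group of all dyadic rearrangements of the Basilica, under composition. Then the abelianization $T_B/[T_B,T_B]$ is isomorphic to $\mathbb{Z}/2\mathbb{Z}$. -/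

import Mathlib

namespace Basilica

/-- An arc of the circle `ℝ / ℤ`, running counterclockwise from (the class of) the real number
`left` to (the class of) the real number `right`. -/
@[ext]
structure Interval where
  left : ℝ
  right : ℝ

/-- The primary arc of an interval joins the two points that divide it in the ratio `1 : 2 : 1`.
The pieces into which it divides the interval are `J.first`, `J.middle` and `J.last`. -/
noncomputable def Interval.first (J : Interval) : Interval :=
  ⟨J.left, J.left + (J.right - J.left) / 4⟩

noncomputable def Interval.middle (J : Interval) : Interval :=
  ⟨J.left + (J.right - J.left) / 4, J.left + 3 * (J.right - J.left) / 4⟩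

noncomputable def Interval.last (J : Interval) : Interval :=
  ⟨J.left + 3 * (J.right - J.left) / 4, J.right⟩

/-- The primary arc of an interval, as the unordered pair of its endpoints on the circle. -/
noncomputable def Interval.primaryArc (J : Interval) : Sym2 UnitAddCircle :=
  s((J.middle.left : UnitAddCircle), (J.middle.right : UnitAddCircle))

/-- A finite recipe for successively attaching primary arcs to an interval: either attach nothing,
or attach the primary arc and go on with each of the three pieces. -/
inductive Subdivision : Type
  | leaf : Subdivision
  | attach (s t u : Subdivision) : Subdivision

/-- The intervals into which `I` is divided. -/
def Subdivision.intervals : Subdivision → Interval → Set Interval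
  | .leaf, I => {I}
  | .attach s t u, I => s.intervals I.first ∪ t.intervals I.middle ∪ u.intervals I.last

/-- The arcs that are attached to `I`. -/
def Subdivision.arcs : Subdivision → Interval → Set (Sym2 UnitAddCircle)
  | .leaf, _ => ∅
  | .attach s t u, I => {I.primaryArc} ∪ (s.arcs I.first ∪ t.arcs I.middle ∪ u.arcs I.last)

/-- The four intervals into which the arcs `{1/3, 2/3}` and `{1/6, 5/6}` divide the circle. -/
noncomputable def baseInterval : Fin 4 → Interval :=
  ![⟨1 / 6, 1 / 3⟩, ⟨1 / 3, 2 / 3⟩, ⟨2 / 3, 5 / 6⟩, ⟨5 / 6, 7 / 6⟩]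

/-- An arc diagram: start with the two arcs `{1/3, 2/3}` and `{1/6, 5/6}`, and successively attach
finitely many primary arcs to the four resulting intervals. -/
structure ArcDiagram where
  sub : Fin 4 → Subdivision

namespace ArcDiagram

/-- The intervals into which an arc diagram divides the circle. Every vertex of the diagram is the
left endpoint of exactly one of them. -/
def intervals (D : ArcDiagram) : Set Interval :=
  ⋃ i, (D.sub i).intervals (baseInterval i)

/-- All arcs of an arc diagram. -/
noncomputable def arcs (D : ArcDiagram) : Set (Sym2 UnitAddCircle) :=
  {s(((1 / 3 : ℝ) : UnitAddCircle), ((2 / 3 : ℝ) : UnitAddCircle)),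
    s(((1 / 6 : ℝ) : UnitAddCircle), ((5 / 6 : ℝ) : UnitAddCircle))} ∪
  ⋃ i, (D.sub i).arcs (baseInterval i)

/-- An orientation-preserving isomorphism between two arc diagrams, regarded as cell structures on
the closed disk: a bijection between the boundary intervals (equivalently, between the vertices,
each interval being labelled by its left endpoint) that respects their counterclockwise succession
and the arcs. The two-dimensional cells are determined by this data. -/
structure Iso (D R : ArcDiagram) where
  toEquiv : D.intervals ≃ R.intervals
  map_adjacent : ∀ J K : D.intervals,
    (J.1.right : UnitAddCircle) = (K.1.left : UnitAddCircle) ↔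
      ((toEquiv J).1.right : UnitAddCircle) = ((toEquiv K).1.left : UnitAddCircle)
  map_arcs : ∀ J K : D.intervals,
    s((J.1.left : UnitAddCircle), (K.1.left : UnitAddCircle)) ∈ D.arcs ↔
      s(((toEquiv J).1.left : UnitAddCircle), ((toEquiv K).1.left : UnitAddCircle)) ∈ R.arcs

end ArcDiagram

/-- `f` maps the interval `J` linearly onto the interval `K`, preserving the orientation. -/
def MapsLinearly (f : UnitAddCircle → UnitAddCircle) (J K : Interval) : Prop :=
  ∀ t ∈ Set.Icc (0 : ℝ) 1,
    f ((J.left + t * (J.right - J.left) : ℝ) : UnitAddCircle) =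
      ((K.left + t * (K.right - K.left) : ℝ) : UnitAddCircle)

/-- A dyadic rearrangement of the Basilica: a homeomorphism of the circle that maps the intervals
of one arc diagram linearly to the corresponding intervals of an isomorphic arc diagram. -/
def IsDyadicRearrangement (f : UnitAddCircle ≃ₜ UnitAddCircle) : Prop :=
  ∃ (D R : ArcDiagram) (φ : D.Iso R), ∀ J : D.intervals, MapsLinearly f J.1 (φ.toEquiv J).1

/-! Helper facts: dyadic rearrangements form a group. -/

theorem Subdivision.bounds (s : Subdivision) : ∀ (I : Interval), I.left < I.right →
    ∀ J ∈ s.intervals I, I.left ≤ J.left ∧ J.left < J.right ∧ J.right ≤ I.right := by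
  induction s with
  | leaf =>
    intro I hI J hJ
    have : J = I := hJ
    subst this
    exact ⟨le_rfl, hI, le_rfl⟩
  | attach s t u hs ht hu =>
    intro I hI J hJ
    rcases hJ with (hJ | hJ) | hJ
    · have := hs I.first (by simp only [Interval.first]; linarith) J hJ
      simp only [Interval.first] at this
      refine ⟨?_, ?_, ?_⟩ <;> linarith
    · have := ht I.middle (by simp only [Interval.middle]; linarith) J hJ
      simp only [Interval.middle] at this
      refine ⟨?_, ?_, ?_⟩ <;> linarith
    · have := hu I.last (by simp only [Interval.last]; linarith) J hJ
      simp only [Interval.last] at this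
      refine ⟨?_, ?_, ?_⟩ <;> linarith

theorem Interval.first_lt {I : Interval} (h : I.left < I.right) :
    I.first.left < I.first.right := by simp only [Interval.first]; linarith

theorem Interval.middle_lt {I : Interval} (h : I.left < I.right) :
    I.middle.left < I.middle.right := by simp only [Interval.middle]; linarith

theorem Interval.last_lt {I : Interval} (h : I.left < I.right) :
    I.last.left < I.last.right := by simp only [Interval.last]; linarith

theorem Subdivision.eq_of_left (s : Subdivision) : ∀ (I : Interval), I.left < I.right →
    ∀ J ∈ s.intervals I, ∀ K ∈ s.intervals I, J.left = K.left → J = K := by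
  induction s with
  | leaf =>
    intro I hI J hJ K hK _
    exact (show J = I from hJ).trans (show K = I from hK).symm
  | attach s t u hs ht hu =>
    intro I hI J hJ K hK h
    have b1 := s.bounds I.first (Interval.first_lt hI)
    have b2 := t.bounds I.middle (Interval.middle_lt hI)
    have b3 := u.bounds I.last (Interval.last_lt hI)
    simp only [Interval.first, Interval.middle, Interval.last] at b1 b2 b3
    rcases hJ with (hJ | hJ) | hJ <;> rcases hK with (hK | hK) | hK
    · exact hs _ (Interval.first_lt hI) J hJ K hK h
    · have := b1 J hJ; have := b2 K hK; linarith
    · have := b1 J hJ; have := b3 K hK; linarith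
    · have := b2 J hJ; have := b1 K hK; linarith
    · exact ht _ (Interval.middle_lt hI) J hJ K hK h
    · have := b2 J hJ; have := b3 K hK; linarith
    · have := b3 J hJ; have := b1 K hK; linarith
    · have := b3 J hJ; have := b2 K hK; linarith
    · exact hu _ (Interval.last_lt hI) J hJ K hK h

theorem Subdivision.exists_left (s : Subdivision) : ∀ I : Interval,
    ∃ J ∈ s.intervals I, J.left = I.left := by
  induction s with
  | leaf => exact fun I => ⟨I, rfl, rfl⟩
  | attach s t u hs _ _ =>
    intro I
    obtain ⟨J, hJ, h⟩ := hs I.first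
    exact ⟨J, Or.inl (Or.inl hJ), h⟩

theorem Subdivision.arc_vertex (s : Subdivision) : ∀ I : Interval, ∀ z ∈ s.arcs I, ∀ x ∈ z,
    ∃ J ∈ s.intervals I, (J.left : UnitAddCircle) = x := by
  induction s with
  | leaf => intro I z hz; exact hz.elim
  | attach s t u hs ht hu =>
    intro I z hz x hx
    rcases hz with hz | (hz | hz) | hz
    · have : z = I.primaryArc := hz
      subst this
      rcases Sym2.mem_iff.1 hx with rfl | rfl
      · obtain ⟨J, hJ, h⟩ := t.exists_left I.middle
        exact ⟨J, Or.inl (Or.inr hJ), by rw [h]⟩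
      · obtain ⟨J, hJ, h⟩ := u.exists_left I.last
        exact ⟨J, Or.inr hJ, by rw [h]; rfl⟩
    · obtain ⟨J, hJ, h⟩ := hs _ z hz x hx
      exact ⟨J, Or.inl (Or.inl hJ), h⟩
    · obtain ⟨J, hJ, h⟩ := ht _ z hz x hx
      exact ⟨J, Or.inl (Or.inr hJ), h⟩
    · obtain ⟨J, hJ, h⟩ := hu _ z hz x hx
      exact ⟨J, Or.inr hJ, h⟩

/-- Continue a subdivision inside each of its intervals. -/
noncomputable def Subdivision.graft :
    Subdivision → Interval → (Interval → Subdivision) → Subdivision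
  | .leaf, I, g => g I
  | .attach s t u, I, g =>
    .attach (s.graft I.first g) (t.graft I.middle g) (u.graft I.last g)

theorem Subdivision.intervals_graft (s : Subdivision) (g : Interval → Subdivision) :
    ∀ I : Interval, (s.graft I g).intervals I = ⋃ J ∈ s.intervals I, (g J).intervals J := by
  induction s with
  | leaf => intro I; simp [Subdivision.graft, Subdivision.intervals]
  | attach s t u hs ht hu =>
    intro I
    simp only [Subdivision.graft, Subdivision.intervals, hs, ht, hu, Set.biUnion_union]

theorem Subdivision.arcs_graft (s : Subdivision) (g : Interval → Subdivision) :
    ∀ I : Interval, (s.graft I g).arcs I = s.arcs I ∪ ⋃ J ∈ s.intervals I, (g J).arcs J := by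
  induction s with
  | leaf => intro I; simp [Subdivision.graft, Subdivision.intervals, Subdivision.arcs]
  | attach s t u hs ht hu =>
    intro I
    simp only [Subdivision.graft, Subdivision.intervals, Subdivision.arcs, hs, ht, hu,
      Set.biUnion_union]
    ext z
    simp only [Set.mem_union]
    tauto

theorem Subdivision.graft_congr (s : Subdivision) (g h : Interval → Subdivision) :
    ∀ I : Interval, (∀ J ∈ s.intervals I, g J = h J) → s.graft I g = s.graft I h := by
  induction s with
  | leaf => exact fun I H => H I rfl
  | attach s t u hs ht hu =>
    intro I H
    simp only [Subdivision.graft]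
    rw [hs I.first fun J hJ => H J (Or.inl (Or.inl hJ)),
      ht I.middle fun J hJ => H J (Or.inl (Or.inr hJ)), hu I.last fun J hJ => H J (Or.inr hJ)]

theorem Subdivision.graft_leaf (s : Subdivision) :
    ∀ I : Interval, s.graft I (fun _ => .leaf) = s := by
  induction s with
  | leaf => exact fun I => rfl
  | attach s t u hs ht hu => intro I; simp only [Subdivision.graft, hs, ht, hu]

theorem Subdivision.exists_combine (s t u : Subdivision) (I : Interval) (hI : I.left < I.right)
    (g₁ g₂ g₃ : Interval → Subdivision) :
    ∃ g, (Subdivision.attach s t u).graft I g =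
      .attach (s.graft I.first g₁) (t.graft I.middle g₂) (u.graft I.last g₃) := by
  classical
  refine ⟨fun J => if J.left < I.middle.left then g₁ J else
    if J.left < I.last.left then g₂ J else g₃ J, ?_⟩
  have b1 := s.bounds I.first (Interval.first_lt hI)
  have b2 := t.bounds I.middle (Interval.middle_lt hI)
  have b3 := u.bounds I.last (Interval.last_lt hI)
  simp only [Subdivision.graft]
  congr 1
  · refine s.graft_congr _ _ _ fun J hJ => ?_
    have := b1 J hJ
    exact if_pos (by simp only [Interval.first, Interval.middle] at this ⊢; linarith)
  · refine t.graft_congr _ _ _ fun J hJ => ?_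
    have := b2 J hJ
    exact (if_neg (by linarith)).trans
      (if_pos (by simp only [Interval.middle, Interval.last] at this ⊢; linarith))
  · refine u.graft_congr _ _ _ fun J hJ => ?_
    have := b3 J hJ
    exact (if_neg (by simp only [Interval.middle, Interval.last] at this ⊢; linarith)).trans
      (if_neg (by linarith))

theorem Subdivision.exists_common (s : Subdivision) : ∀ (t : Subdivision) (I : Interval),
    I.left < I.right → ∃ a b, s.graft I a = t.graft I b := by
  induction s with
  | leaf => exact fun t I _ => ⟨fun _ => t, fun _ => .leaf, (t.graft_leaf I).symm⟩
  | attach s₁ s₂ s₃ h₁ h₂ h₃ =>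
    intro t I hI
    cases t with
    | leaf => exact ⟨fun _ => .leaf, fun _ => .attach s₁ s₂ s₃, Subdivision.graft_leaf _ I⟩
    | attach t₁ t₂ t₃ =>
      obtain ⟨a₁, b₁, e₁⟩ := h₁ t₁ I.first (Interval.first_lt hI)
      obtain ⟨a₂, b₂, e₂⟩ := h₂ t₂ I.middle (Interval.middle_lt hI)
      obtain ⟨a₃, b₃, e₃⟩ := h₃ t₃ I.last (Interval.last_lt hI)
      obtain ⟨a, ha⟩ := Subdivision.exists_combine s₁ s₂ s₃ I hI a₁ a₂ a₃
      obtain ⟨b, hb⟩ := Subdivision.exists_combine t₁ t₂ t₃ I hI b₁ b₂ b₃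
      exact ⟨a, b, by rw [ha, hb, e₁, e₂, e₃]⟩

theorem baseInterval_lt (i : Fin 4) : (baseInterval i).left < (baseInterval i).right := by
  fin_cases i <;> simp [baseInterval] <;> norm_num

theorem baseInterval_mem (i : Fin 4) :
    1 / 6 ≤ (baseInterval i).left ∧ (baseInterval i).right ≤ 7 / 6 := by
  fin_cases i <;> simp [baseInterval] <;> norm_num

theorem baseInterval_mono {i j : Fin 4} (h : i < j) :
    (baseInterval i).right ≤ (baseInterval j).left := by
  fin_cases i <;> fin_cases j <;> simp [baseInterval] at h ⊢ <;> norm_num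

namespace ArcDiagram

theorem index_unique (D E : ArcDiagram) {i j : Fin 4} {J K : Interval}
    (hJ : J ∈ (D.sub i).intervals (baseInterval i))
    (hK : K ∈ (E.sub j).intervals (baseInterval j)) (h : J.left = K.left) : i = j := by
  have b1 := (D.sub i).bounds _ (baseInterval_lt i) J hJ
  have b2 := (E.sub j).bounds _ (baseInterval_lt j) K hK
  rcases lt_trichotomy i j with hij | hij | hij
  · have := baseInterval_mono hij; linarith
  · exact hij
  · have := baseInterval_mono hij; linarith

theorem eq_of_coe_left (D : ArcDiagram) {J K : Interval} (hJ : J ∈ D.intervals)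
    (hK : K ∈ D.intervals) (h : (J.left : UnitAddCircle) = (K.left : UnitAddCircle)) :
    J = K := by
  obtain ⟨i, hi⟩ := Set.mem_iUnion.1 hJ
  obtain ⟨j, hj⟩ := Set.mem_iUnion.1 hK
  have b1 := (D.sub i).bounds _ (baseInterval_lt i) J hi
  have b2 := (D.sub j).bounds _ (baseInterval_lt j) K hj
  have c1 := baseInterval_mem i
  have c2 := baseInterval_mem j
  have h' : J.left = K.left := by
    refine (AddCircle.coe_eq_coe_iff_of_mem_Ico (p := (1 : ℝ)) (a := 1 / 6) ?_ ?_).1 h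
    · constructor <;> linarith
    · constructor <;> linarith
  obtain rfl := D.index_unique D hi hj h'
  exact (D.sub i).eq_of_left _ (baseInterval_lt i) J hi K hj h'

theorem arc_vertex (D : ArcDiagram) {z : Sym2 UnitAddCircle} (hz : z ∈ D.arcs)
    {x : UnitAddCircle} (hx : x ∈ z) : ∃ J ∈ D.intervals, (J.left : UnitAddCircle) = x := by
  have key : ∀ i, ∃ J ∈ D.intervals, J.left = (baseInterval i).left := by
    intro i
    obtain ⟨J, hJ, h⟩ := (D.sub i).exists_left (baseInterval i)
    exact ⟨J, Set.mem_iUnion.2 ⟨i, hJ⟩, h⟩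
  rcases hz with (rfl | hz) | hz
  · rcases Sym2.mem_iff.1 hx with rfl | rfl
    · obtain ⟨J, hJ, h⟩ := key 1
      exact ⟨J, hJ, by rw [h]; rfl⟩
    · obtain ⟨J, hJ, h⟩ := key 2
      exact ⟨J, hJ, by rw [h]; rfl⟩
  · have hz' : z = _ := hz
    subst hz'
    rcases Sym2.mem_iff.1 hx with rfl | rfl
    · obtain ⟨J, hJ, h⟩ := key 0
      exact ⟨J, hJ, by rw [h]; rfl⟩
    · obtain ⟨J, hJ, h⟩ := key 3
      exact ⟨J, hJ, by rw [h]; rfl⟩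
  · obtain ⟨i, hi⟩ := Set.mem_iUnion.1 hz
    obtain ⟨J, hJ, h⟩ := (D.sub i).arc_vertex _ z hi x hx
    exact ⟨J, Set.mem_iUnion.2 ⟨i, hJ⟩, h⟩

/-- Continue an arc diagram inside each of its intervals. -/
noncomputable def graft (D : ArcDiagram) (g : Interval → Subdivision) : ArcDiagram :=
  ⟨fun i => (D.sub i).graft (baseInterval i) g⟩

theorem intervals_graft (D : ArcDiagram) (g : Interval → Subdivision) :
    (D.graft g).intervals = ⋃ J ∈ D.intervals, (g J).intervals J := by
  simp only [intervals, graft, Subdivision.intervals_graft, Set.biUnion_iUnion]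

theorem arcs_graft (D : ArcDiagram) (g : Interval → Subdivision) :
    (D.graft g).arcs = D.arcs ∪ ⋃ J ∈ D.intervals, (g J).arcs J := by
  simp only [intervals, arcs, graft, Subdivision.arcs_graft, Set.biUnion_iUnion,
    Set.iUnion_union_distrib, Set.union_assoc]

theorem exists_common (D E : ArcDiagram) : ∃ a b, D.graft a = E.graft b := by
  classical
  choose a b h using fun i => (D.sub i).exists_common (E.sub i) _ (baseInterval_lt i)
  have key : ∀ (F : ArcDiagram) (c : Fin 4 → Interval → Subdivision),
      ∃ c', ∀ i, (F.sub i).graft (baseInterval i) c' = (F.sub i).graft (baseInterval i) (c i) := by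
    intro F c
    refine ⟨fun J => if H : ∃ i, J ∈ (F.sub i).intervals (baseInterval i) then c H.choose J
      else .leaf, fun i => ?_⟩
    refine Subdivision.graft_congr _ _ _ _ fun J hJ => ?_
    have H : ∃ i, J ∈ (F.sub i).intervals (baseInterval i) := ⟨i, hJ⟩
    rw [dif_pos H, F.index_unique F H.choose_spec hJ rfl]
  obtain ⟨a', ha⟩ := key D a
  obtain ⟨b', hb⟩ := key E b
  refine ⟨a', b', ?_⟩
  simp only [graft, ArcDiagram.mk.injEq]
  funext i
  rw [ha, hb, h]

end ArcDiagram

theorem MapsLinearly.left {f : UnitAddCircle → UnitAddCircle} {J K : Interval}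
    (h : MapsLinearly f J K) : f (J.left : UnitAddCircle) = (K.left : UnitAddCircle) := by
  simpa using h 0 (by simp)

theorem MapsLinearly.right {f : UnitAddCircle → UnitAddCircle} {J K : Interval}
    (h : MapsLinearly f J K) : f (J.right : UnitAddCircle) = (K.right : UnitAddCircle) := by
  simpa using h 1 (by simp)

theorem MapsLinearly.first {f : UnitAddCircle → UnitAddCircle} {J K : Interval}
    (h : MapsLinearly f J K) : MapsLinearly f J.first K.first := by
  rintro t ⟨h0, h1⟩
  convert h (t / 4) ⟨by linarith, by linarith⟩ using 3 <;> simp only [Interval.first] <;> ring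

theorem MapsLinearly.middle {f : UnitAddCircle → UnitAddCircle} {J K : Interval}
    (h : MapsLinearly f J K) : MapsLinearly f J.middle K.middle := by
  rintro t ⟨h0, h1⟩
  have e : ∀ I : Interval, I.middle.left + t * (I.middle.right - I.middle.left) =
      I.left + (1 / 4 + t / 2) * (I.right - I.left) := by
    intro I
    simp only [Interval.middle]
    ring
  rw [e, e]
  exact h _ ⟨by linarith, by linarith⟩

theorem MapsLinearly.last {f : UnitAddCircle → UnitAddCircle} {J K : Interval}
    (h : MapsLinearly f J K) : MapsLinearly f J.last K.last := by
  rintro t ⟨h0, h1⟩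
  have e : ∀ I : Interval, I.last.left + t * (I.last.right - I.last.left) =
      I.left + (3 / 4 + t / 4) * (I.right - I.left) := by
    intro I
    simp only [Interval.last]
    ring
  rw [e, e]
  exact h _ ⟨by linarith, by linarith⟩

/-- `f` carries a set of intervals and a set of arcs to another one. -/
structure Carries (f : UnitAddCircle → UnitAddCircle) (A B : Set Interval)
    (a b : Set (Sym2 UnitAddCircle)) : Prop where
  fwd : ∀ J ∈ A, ∃ K ∈ B, MapsLinearly f J K
  bwd : ∀ K ∈ B, ∃ J ∈ A, MapsLinearly f J K
  arcs : Sym2.map f '' a = b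

theorem Carries.union {f : UnitAddCircle → UnitAddCircle} {A B A' B' : Set Interval}
    {a b a' b' : Set (Sym2 UnitAddCircle)} (h : Carries f A B a b) (h' : Carries f A' B' a' b') :
    Carries f (A ∪ A') (B ∪ B') (a ∪ a') (b ∪ b') := by
  refine ⟨?_, ?_, by rw [Set.image_union, h.arcs, h'.arcs]⟩
  · rintro J (hJ | hJ)
    · obtain ⟨K, hK, H⟩ := h.fwd J hJ
      exact ⟨K, Or.inl hK, H⟩
    · obtain ⟨K, hK, H⟩ := h'.fwd J hJ
      exact ⟨K, Or.inr hK, H⟩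
  · rintro J (hJ | hJ)
    · obtain ⟨K, hK, H⟩ := h.bwd J hJ
      exact ⟨K, Or.inl hK, H⟩
    · obtain ⟨K, hK, H⟩ := h'.bwd J hJ
      exact ⟨K, Or.inr hK, H⟩

theorem Subdivision.carries (s : Subdivision) {f : UnitAddCircle → UnitAddCircle} :
    ∀ {J K : Interval}, MapsLinearly f J K →
      Carries f (s.intervals J) (s.intervals K) (s.arcs J) (s.arcs K) := by
  induction s with
  | leaf =>
    intro J K h
    refine ⟨?_, ?_, by simp [Subdivision.arcs]⟩
    · rintro _ rfl; exact ⟨K, rfl, h⟩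
    · rintro _ rfl; exact ⟨J, rfl, h⟩
  | attach s t u hs ht hu =>
    intro J K h
    have H := ((hs h.first).union (ht h.middle)).union (hu h.last)
    refine ⟨H.fwd, H.bwd, ?_⟩
    simp only [Subdivision.arcs]
    rw [Set.image_union, H.arcs, Set.image_singleton]
    congr 2
    simp only [Interval.primaryArc, Sym2.map_mk, h.middle.left, h.middle.right]

/-- `f` carries one arc diagram to another. -/
def ArcDiagram.Carried (f : UnitAddCircle → UnitAddCircle) (D R : ArcDiagram) : Prop :=
  Carries f D.intervals R.intervals D.arcs R.arcs

namespace ArcDiagram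

theorem Carried.graft {f : UnitAddCircle → UnitAddCircle} {D R : ArcDiagram}
    (h : Carried f D R) (g : Interval → Subdivision) : ∃ g', Carried f (D.graft g') (R.graft g) := by
  classical
  choose! k hk hl using h.fwd
  have uniq : ∀ J ∈ D.intervals, ∀ K ∈ R.intervals, MapsLinearly f J K → k J = K := by
    intro J hJ K hK H
    exact R.eq_of_coe_left (hk J hJ) hK ((hl J hJ).left.symm.trans H.left)
  refine ⟨fun J => g (k J), ?_⟩
  have main : ∀ J ∈ D.intervals, Carries f ((g (k J)).intervals J) ((g (k J)).intervals (k J))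
      ((g (k J)).arcs J) ((g (k J)).arcs (k J)) := fun J hJ => (g (k J)).carries (hl J hJ)
  rw [Carried, intervals_graft, intervals_graft, arcs_graft, arcs_graft]
  refine ⟨?_, ?_, ?_⟩
  · intro J' hJ'
    obtain ⟨J, hJ, hJ'⟩ := Set.mem_iUnion₂.1 hJ'
    obtain ⟨K', hK', H⟩ := (main J hJ).fwd J' hJ'
    exact ⟨K', Set.mem_iUnion₂.2 ⟨k J, hk J hJ, hK'⟩, H⟩
  · intro K' hK'
    obtain ⟨K, hK, hK'⟩ := Set.mem_iUnion₂.1 hK'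
    obtain ⟨J, hJ, H⟩ := h.bwd K hK
    obtain rfl := uniq J hJ K hK H
    obtain ⟨J', hJ', H'⟩ := (main J hJ).bwd K' hK'
    exact ⟨J', Set.mem_iUnion₂.2 ⟨J, hJ, hJ'⟩, H'⟩
  · rw [Set.image_union, h.arcs, Set.image_iUnion₂]
    congr 1
    ext z
    simp only [Set.mem_iUnion]
    constructor
    · rintro ⟨J, hJ, hz⟩
      rw [(main J hJ).arcs] at hz
      exact ⟨k J, hk J hJ, hz⟩
    · rintro ⟨K, hK, hz⟩
      obtain ⟨J, hJ, H⟩ := h.bwd K hK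
      obtain rfl := uniq J hJ K hK H
      exact ⟨J, hJ, by rwa [(main J hJ).arcs]⟩

theorem Carried.symm {f : UnitAddCircle ≃ₜ UnitAddCircle} {D R : ArcDiagram}
    (h : Carried f D R) : Carried f.symm R D := by
  have key : ∀ {J K : Interval}, MapsLinearly f J K → MapsLinearly f.symm K J := by
    intro J K H t ht
    rw [← H t ht, f.symm_apply_apply]
  refine ⟨?_, ?_, ?_⟩
  · intro K hK
    obtain ⟨J, hJ, H⟩ := h.bwd K hK
    exact ⟨J, hJ, key H⟩
  · intro J hJ
    obtain ⟨K, hK, H⟩ := h.fwd J hJ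
    exact ⟨K, hK, key H⟩
  · have : Sym2.map f.symm ∘ Sym2.map f = id := by
      rw [← Sym2.map_comp]
      simp
    rw [← h.arcs, ← Set.image_comp, this, Set.image_id]

theorem Carried.comp {f g : UnitAddCircle → UnitAddCircle} {D E R : ArcDiagram}
    (h : Carried f D E) (h' : Carried g E R) : Carried (g ∘ f) D R := by
  have key : ∀ {J K L : Interval}, MapsLinearly f J K → MapsLinearly g K L →
      MapsLinearly (g ∘ f) J L := by
    intro J K L H H' t ht
    rw [Function.comp_apply, H t ht, H' t ht]
  refine ⟨?_, ?_, ?_⟩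
  · intro J hJ
    obtain ⟨K, hK, H⟩ := h.fwd J hJ
    obtain ⟨L, hL, H'⟩ := h'.fwd K hK
    exact ⟨L, hL, key H H'⟩
  · intro L hL
    obtain ⟨K, hK, H⟩ := h'.bwd L hL
    obtain ⟨J, hJ, H'⟩ := h.bwd K hK
    exact ⟨J, hJ, key H' H⟩
  · rw [Sym2.map_comp, Set.image_comp, h.arcs, h'.arcs]

end ArcDiagram

theorem isDyadicRearrangement_iff (f : UnitAddCircle ≃ₜ UnitAddCircle) :
    IsDyadicRearrangement f ↔ ∃ D R : ArcDiagram, ArcDiagram.Carried f D R := by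
  constructor
  · rintro ⟨D, R, φ, h⟩
    refine ⟨D, R, ?_, ?_, ?_⟩
    · exact fun J hJ => ⟨_, (φ.toEquiv ⟨J, hJ⟩).2, h ⟨J, hJ⟩⟩
    · intro K hK
      refine ⟨_, (φ.toEquiv.symm ⟨K, hK⟩).2, ?_⟩
      simpa using h (φ.toEquiv.symm ⟨K, hK⟩)
    · ext z
      constructor
      · rintro ⟨w, hw, rfl⟩
        induction w using Sym2.ind with
        | _ x y =>
          obtain ⟨J, hJ, rfl⟩ := D.arc_vertex hw (Sym2.mem_mk_left x y)
          obtain ⟨K, hK, rfl⟩ := D.arc_vertex hw (Sym2.mem_mk_right _ y)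
          rw [Sym2.map_mk, (h ⟨J, hJ⟩).left, (h ⟨K, hK⟩).left]
          exact (φ.map_arcs ⟨J, hJ⟩ ⟨K, hK⟩).1 hw
      · intro hz
        induction z using Sym2.ind with
        | _ x y =>
          obtain ⟨J, hJ, rfl⟩ := R.arc_vertex hz (Sym2.mem_mk_left x y)
          obtain ⟨K, hK, rfl⟩ := R.arc_vertex hz (Sym2.mem_mk_right _ y)
          refine ⟨_, (φ.map_arcs (φ.toEquiv.symm ⟨J, hJ⟩) (φ.toEquiv.symm ⟨K, hK⟩)).2
            (by simpa using hz), ?_⟩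
          rw [Sym2.map_mk, (h (φ.toEquiv.symm ⟨J, hJ⟩)).left,
            (h (φ.toEquiv.symm ⟨K, hK⟩)).left]
          simp
  · rintro ⟨D, R, h⟩
    choose k hk using fun J : D.intervals => h.fwd J.1 J.2
    have hbij : Function.Bijective fun J : D.intervals => (⟨k J, (hk J).1⟩ : R.intervals) := by
      constructor
      · intro J K H
        have H' : k J = k K := congrArg Subtype.val H
        refine Subtype.ext (D.eq_of_coe_left J.2 K.2 (f.injective ?_))
        rw [(hk J).2.left, (hk K).2.left, H']
      · rintro ⟨K, hK⟩
        obtain ⟨J, hJ, H⟩ := h.bwd K hK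
        refine ⟨⟨J, hJ⟩, Subtype.ext (R.eq_of_coe_left (hk ⟨J, hJ⟩).1 hK ?_)⟩
        rw [← (hk ⟨J, hJ⟩).2.left, ← H.left]
    refine ⟨D, R, ⟨Equiv.ofBijective _ hbij, ?_, ?_⟩, fun J => (hk J).2⟩
    · intro J K
      simp only [Equiv.ofBijective_apply]
      rw [← (hk J).2.right, ← (hk K).2.left, f.injective.eq_iff]
    · intro J K
      simp only [Equiv.ofBijective_apply]
      rw [← (hk J).2.left, ← (hk K).2.left, ← h.arcs]
      exact ((Sym2.map.injective f.injective).mem_set_image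
        (a := s((J.1.left : UnitAddCircle), (K.1.left : UnitAddCircle)))).symm

/-- The group `T_B` of all dyadic rearrangements of the Basilica, under composition. -/
def TB : Subgroup (UnitAddCircle ≃ₜ UnitAddCircle) where
  carrier := {f | IsDyadicRearrangement f}
  one_mem' := by
    refine (isDyadicRearrangement_iff _).2 ⟨⟨fun _ => .leaf⟩, ⟨fun _ => .leaf⟩, ?_, ?_, ?_⟩
    · exact fun J hJ => ⟨J, hJ, fun _ _ => rfl⟩
    · exact fun J hJ => ⟨J, hJ, fun _ _ => rfl⟩
    · have : Sym2.map ((1 : UnitAddCircle ≃ₜ UnitAddCircle) : UnitAddCircle → UnitAddCircle)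
          = id := Sym2.map_id
      rw [this, Set.image_id]
  mul_mem' := by
    intro g f hg hf
    obtain ⟨D, E, h⟩ := (isDyadicRearrangement_iff _).1 hf
    obtain ⟨E', R, h'⟩ := (isDyadicRearrangement_iff _).1 hg
    obtain ⟨a, b, hab⟩ := E.exists_common E'
    obtain ⟨a', ha⟩ := h.graft a
    obtain ⟨b', hb⟩ := h'.symm.graft b
    rw [← hab] at hb
    exact (isDyadicRearrangement_iff _).2 ⟨_, _, ha.comp hb.symm⟩
  inv_mem' := by
    intro f hf
    obtain ⟨D, R, h⟩ := (isDyadicRearrangement_iff _).1 hf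
    exact (isDyadicRearrangement_iff _).2 ⟨R, D, h.symm⟩

end Basilica

namespace Basilica

/-! ### Circle homeomorphisms from order automorphisms of the line -/

/-! The quotient `ℤ/2` is detected by slopes. All pieces of an arc diagram have width `2 ^ n / 6`,
and the parity of `n` (the colour) alternates around the circle, because a primary arc cuts widths
in the ratio `1 : 2 : 1` and the four base widths are `1/6, 1/3, 1/6, 1/3`. Hence a rearrangement
either preserves all colours or changes all of them. The exponents of its slopes therefore share one
parity, and this is a homomorphism `parity` to `ℤ/2`. The flip `d`, which exchanges the two sides of
the arc `{1/6, 5/6}`, has slope `1/2` on one side and so is odd.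

It remains to see that every class in the abelianization is `1` or that of `d`. The heart is
`Generators.of_eq_one`: an element that is the identity on `[5/6, 7/6]` is trivial there. Such an
element acts on the complementary interval `flank = [1/6, 5/6]`. The first three base intervals are
the three pieces of `flank`, so it carries one ternary subdivision of `flank` to another, preserving
the order of the vertices and the arcs. The arcs form a noncrossing matching, so both subdivisions
have the same parenthesis word, and ternary trees with the same word differ by the move `((s, t, u),
t', u') ↔ (s, t, (u, t', u'))`. Each move is realized by an associator, and a map supported on
`flank` is determined by the pieces it carries linearly. Thus the element is a product of
associators and their inverses.

Associators die by the pentagon relation. Let `x` be the associator of `flank` and `y` that of its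
first piece. All associators occurring in the pentagon for `y` are conjugate to `y`, so that `y² =
y³` in the abelianization and `y = 1`. The pentagon for `x` then reads `x² = x y²`, whence `x = 1`.
Every other associator is conjugate to `x` or `y`.

Finally, with `r` the half turn, `d²`, `r²` and `(r x)³` fix `[5/6, 7/6]` pointwise, so `d² = 1`,
and `r² = r³ = 1` gives `r = 1`. The generators `r`, `d`, `x` move the middle piece of any interval
to `[5/6, 7/6]`, so every element becomes one that fixes this interval after multiplication by words
in `r`, `d`, `x` on both sides (`Generators.of_eq`). -/

theorem circleLift_apply {A B : ℝ} (e : ℝ ≃o ℝ) (h0 : e A = B) (h1 : e (A + 1) = B + 1)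
    {x : ℝ} (hx : x ∈ Set.Icc A (A + 1)) :
    AddCircle.liftIco (1 : ℝ) A (fun t => (e t : UnitAddCircle)) (x : UnitAddCircle) =
      (e x : UnitAddCircle) := by
  rcases hx.2.lt_or_eq with h | rfl
  · exact AddCircle.liftIco_coe_apply ⟨hx.1, h⟩
  -- The right end of the period lies outside the fundamental domain of `liftIco`. Both sides still
  -- agree there because `e A` and `e (A + 1)` differ by a full turn; `e` need not be periodic.
  · have key : ∀ a : ℝ, ((a + 1 : ℝ) : UnitAddCircle) = a := AddCircle.coe_add_period 1
    have hA : A ∈ Set.Ico A (A + 1) := ⟨le_rfl, by linarith⟩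
    rw [AddCircle.coe_add_period, h1, AddCircle.coe_add_period, ← h0]
    exact AddCircle.liftIco_coe_apply hA

/-- The homeomorphism of the circle induced by an order automorphism of the line that maps
`[A, A + 1]` onto `[B, B + 1]`. -/
noncomputable def circleHomeo (A B : ℝ) (e : ℝ ≃o ℝ) (h0 : e A = B) (h1 : e (A + 1) = B + 1) :
    UnitAddCircle ≃ₜ UnitAddCircle where
  toFun := AddCircle.liftIco (1 : ℝ) A fun t => (e t : UnitAddCircle)
  invFun := AddCircle.liftIco (1 : ℝ) B fun t => (e.symm t : UnitAddCircle)
  left_inv z := by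
    obtain ⟨x, hx, rfl⟩ : z ∈ ((↑) : ℝ → UnitAddCircle) '' Set.Icc A (A + 1) := by
      rw [AddCircle.coe_image_Icc_eq]; trivial
    rw [circleLift_apply e h0 h1 hx, circleLift_apply e.symm (A := B) (B := A)
      (by simp [← h0]) (by simp [← h1])
      ⟨h0 ▸ e.monotone hx.1, h1 ▸ e.monotone hx.2⟩, e.symm_apply_apply]
  right_inv z := by
    have h0' : e.symm B = A := by simp [← h0]
    have h1' : e.symm (B + 1) = A + 1 := by simp [← h1]
    obtain ⟨x, hx, rfl⟩ : z ∈ ((↑) : ℝ → UnitAddCircle) '' Set.Icc B (B + 1) := by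
      rw [AddCircle.coe_image_Icc_eq]; trivial
    rw [circleLift_apply e.symm h0' h1' hx, circleLift_apply e h0 h1
      ⟨h0' ▸ e.symm.monotone hx.1, h1' ▸ e.symm.monotone hx.2⟩, e.apply_symm_apply]
  continuous_toFun := AddCircle.liftIco_continuous
    (by rw [h0, h1, AddCircle.coe_add_period])
    ((AddCircle.continuous_mk' _).comp e.continuous).continuousOn
  continuous_invFun := AddCircle.liftIco_continuous
    (by rw [show e.symm B = A by simp [← h0], show e.symm (B + 1) = A + 1 by simp [← h1],
      AddCircle.coe_add_period])
    ((AddCircle.continuous_mk' _).comp e.symm.continuous).continuousOn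

theorem circleHomeo_apply {A B : ℝ} (e : ℝ ≃o ℝ) (h0 : e A = B) (h1 : e (A + 1) = B + 1)
    {x : ℝ} (hx : x ∈ Set.Icc A (A + 1)) :
    circleHomeo A B e h0 h1 (x : UnitAddCircle) = (e x : UnitAddCircle) :=
  circleLift_apply e h0 h1 hx

/-! ### Linear maps between intervals -/

theorem MapsLinearly.comp {f g : UnitAddCircle → UnitAddCircle} {J K L : Interval}
    (hg : MapsLinearly g K L) (hf : MapsLinearly f J K) : MapsLinearly (g ∘ f) J L := by
  intro t ht
  rw [Function.comp_apply, hf t ht, hg t ht]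

theorem MapsLinearly.mul {f g : UnitAddCircle ≃ₜ UnitAddCircle} {J K L : Interval}
    (hg : MapsLinearly g K L) (hf : MapsLinearly f J K) : MapsLinearly (g * f : _ ≃ₜ _) J L :=
  MapsLinearly.comp (f := f) (g := g) hg hf

theorem MapsLinearly.inv {f : UnitAddCircle ≃ₜ UnitAddCircle} {J K : Interval}
    (h : MapsLinearly f J K) : MapsLinearly (f⁻¹ : _ ≃ₜ _) K J := by
  intro t ht
  rw [← h t ht]
  exact f.symm_apply_apply _

theorem mapsLinearly_one (J : Interval) :
    MapsLinearly (1 : UnitAddCircle ≃ₜ UnitAddCircle) J J := fun _ _ => rfl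

/-- The open arc of the circle underlying an interval. -/
def Interval.openArc (J : Interval) : Set UnitAddCircle :=
  ((↑) : ℝ → UnitAddCircle) '' Set.Ioo J.left J.right

theorem MapsLinearly.mem_openArc {f : UnitAddCircle → UnitAddCircle} {J K : Interval}
    (h : MapsLinearly f J K) (hK : K.left < K.right) {z : UnitAddCircle}
    (hz : z ∈ J.openArc) : f z ∈ K.openArc := by
  obtain ⟨x, ⟨h1, h2⟩, rfl⟩ := hz
  have hw : 0 < J.right - J.left := by linarith
  have hw' : 0 < K.right - K.left := by linarith
  have ht0 : 0 < (x - J.left) / (J.right - J.left) := div_pos (by linarith) hw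
  have ht1 : (x - J.left) / (J.right - J.left) < 1 := (div_lt_one hw).2 (by linarith)
  have := h _ ⟨ht0.le, ht1.le⟩
  rw [div_mul_cancel₀ _ hw.ne', add_sub_cancel] at this
  rw [this]
  refine ⟨_, ⟨?_, ?_⟩, rfl⟩
  · nlinarith
  · nlinarith

/-- `f` is the identity outside the open arc of `J`. -/
def SupportedOn (f : UnitAddCircle → UnitAddCircle) (J : Interval) : Prop :=
  ∀ z, z ∉ J.openArc → f z = z

theorem coe_real_eq_iff {x y : ℝ} :
    (x : UnitAddCircle) = (y : UnitAddCircle) ↔ ∃ n : ℤ, x = y + n := by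
  rw [← sub_eq_zero, ← AddCircle.coe_sub, AddCircle.coe_eq_zero_iff]
  refine exists_congr fun n => ?_
  rw [zsmul_eq_mul, mul_one]
  constructor <;> intro h <;> linarith

theorem notMem_openArc {J : Interval} {x : ℝ} (h1 : J.right ≤ x) (h2 : x ≤ J.left + 1) :
    (x : UnitAddCircle) ∉ J.openArc := by
  rintro ⟨y, ⟨hy1, hy2⟩, h⟩
  obtain ⟨n, hn⟩ := coe_real_eq_iff.1 h
  -- Two representatives of one point differ by an integer, which would here lie strictly between
  -- `-1` and `0`.
  have h3 : (n : ℝ) < 0 := by linarith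
  have h4 : (-1 : ℝ) < n := by linarith
  have h3' : n < 0 := by exact_mod_cast h3
  have h4' : (-1 : ℤ) < n := by exact_mod_cast h4
  omega

theorem notMem_openArc' {J : Interval} {x : ℝ} (h1 : J.right ≤ x + 1) (h2 : x ≤ J.left) :
    (x : UnitAddCircle) ∉ J.openArc := by
  have := notMem_openArc (J := J) (x := x + 1) h1 (by linarith)
  rwa [AddCircle.coe_add_period] at this

theorem lerp_mem {l r t : ℝ} (hlr : l ≤ r) (ht : t ∈ Set.Icc (0 : ℝ) 1) :
    l ≤ l + t * (r - l) ∧ l + t * (r - l) ≤ r := by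
  obtain ⟨h0, h1⟩ := ht
  constructor <;> nlinarith

theorem SupportedOn.fix_after {f : UnitAddCircle → UnitAddCircle} {J K : Interval}
    (h : SupportedOn f J) (hK : K.left ≤ K.right) (h1 : J.right ≤ K.left)
    (h2 : K.right ≤ J.left + 1) : MapsLinearly f K K := by
  intro t ht
  obtain ⟨a, b⟩ := lerp_mem hK ht
  exact h _ (notMem_openArc (by linarith) (by linarith))

theorem SupportedOn.fix_before {f : UnitAddCircle → UnitAddCircle} {J K : Interval}
    (h : SupportedOn f J) (hK : K.left ≤ K.right) (h1 : K.right ≤ J.left)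
    (h2 : J.right ≤ K.left + 1) : MapsLinearly f K K := by
  intro t ht
  obtain ⟨a, b⟩ := lerp_mem hK ht
  exact h _ (notMem_openArc' (by linarith) (by linarith))

theorem SupportedOn.mono {f : UnitAddCircle → UnitAddCircle} {J K : Interval}
    (h : SupportedOn f J) (h1 : K.left ≤ J.left) (h2 : J.right ≤ K.right) : SupportedOn f K :=
  fun z hz => h z fun hz' => hz (Set.image_mono (Set.Ioo_subset_Ioo h1 h2) hz')

theorem SupportedOn.mul {f g : UnitAddCircle ≃ₜ UnitAddCircle} {J : Interval}
    (hg : SupportedOn g J) (hf : SupportedOn f J) : SupportedOn (g * f : _ ≃ₜ _) J := by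
  intro z hz
  change g (f z) = z
  rw [hf z hz, hg z hz]

theorem SupportedOn.inv {f : UnitAddCircle ≃ₜ UnitAddCircle} {J : Interval}
    (hf : SupportedOn f J) : SupportedOn (f⁻¹ : _ ≃ₜ _) J := by
  intro z hz
  change f.symm z = z
  rw [Homeomorph.symm_apply_eq, hf z hz]

theorem SupportedOn.conj {f g : UnitAddCircle ≃ₜ UnitAddCircle} {J K : Interval}
    (hf : SupportedOn f J) (hg : MapsLinearly g J K)
    (hK : K.left < K.right) : SupportedOn (g * f * g⁻¹ : _ ≃ₜ _) K := by
  intro z hz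
  change g (f (g.symm z)) = z
  rw [hf, g.apply_symm_apply]
  intro hz'
  apply hz
  simpa using hg.mem_openArc hK hz'

/-! ### Associators -/

/-- `f` rearranges `J` as if by rebracketing: it replaces the subdivision of `J` and of `J.first`
by the subdivision of `J` and of `J.last`. -/
structure IsAssociator (f : UnitAddCircle → UnitAddCircle) (J : Interval) : Prop where
  supp : SupportedOn f J
  map₁ : MapsLinearly f J.first.first J.first
  map₂ : MapsLinearly f J.first.middle J.middle
  map₃ : MapsLinearly f J.first.last J.last.first
  map₄ : MapsLinearly f J.middle J.last.middle
  map₅ : MapsLinearly f J.last J.last.last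

/-- A linear map respects the `1 : 2 : 1` division at every depth, so all five linear pieces are
transported. This makes associators of different intervals conjugate to each other. -/
theorem IsAssociator.conj {f g : UnitAddCircle ≃ₜ UnitAddCircle} {J K : Interval}
    (hf : IsAssociator f J) (hg : MapsLinearly g J K)
    (hK : K.left < K.right) : IsAssociator (g * f * g⁻¹ : _ ≃ₜ _) K where
  supp := hf.supp.conj hg hK
  map₁ := (hg.first.mul hf.map₁).mul hg.first.first.inv
  map₂ := (hg.middle.mul hf.map₂).mul hg.first.middle.inv
  map₃ := (hg.last.first.mul hf.map₃).mul hg.first.last.inv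
  map₄ := (hg.last.middle.mul hf.map₄).mul hg.middle.inv
  map₅ := (hg.last.last.mul hf.map₅).mul hg.last.inv

/-- The order automorphism of the line underlying the associator of `[l, r]`. -/
noncomputable def assocIso (l r : ℝ) (h : l < r) : ℝ ≃o ℝ :=
  Equiv.toOrderIso
    -- On `[l, r]` the associator is concave with slopes `4`, `1`, `1/4`, hence the minimum of its
    -- three affine branches: the first fixes `l`, the last fixes `r`, and the middle one is the
    -- shift by `9/16` of the width. The maximum with `t` makes it the identity elsewhere.
    { toFun := fun t => max t (min (4 * t - 3 * l) (min (t + 9 * (r - l) / 16) ((t + 3 * r) / 4)))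
      invFun := fun t => min t (max ((t + 3 * l) / 4) (max (t - 9 * (r - l) / 16) (4 * t - 3 * r)))
      left_inv := by
        intro t
        simp only []
        grind
      right_inv := by
        intro t
        simp only []
        grind }
    (by intro s t hst; simp only [Equiv.coe_fn_mk]; gcongr)
    (by intro s t hst; simp only [Equiv.coe_fn_symm_mk]; gcongr)

theorem assocIso_apply (l r : ℝ) (h : l < r) (t : ℝ) : assocIso l r h t =
    max t (min (4 * t - 3 * l) (min (t + 9 * (r - l) / 16) ((t + 3 * r) / 4))) := rfl

theorem assocIso_out {l r : ℝ} (h : l < r) {t : ℝ} (ht : t ≤ l ∨ r ≤ t) :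
    assocIso l r h t = t := by
  rw [assocIso_apply]; grind

theorem assocIso_left {l r : ℝ} (h : l < r) {t : ℝ} (h0 : l ≤ t) (h1 : 16 * t ≤ 13 * l + 3 * r) :
    assocIso l r h t = 4 * t - 3 * l := by
  rw [assocIso_apply]; grind

theorem assocIso_mid {l r : ℝ} (h : l < r) {t : ℝ} (h0 : 13 * l + 3 * r ≤ 16 * t)
    (h1 : 4 * t ≤ 3 * l + r) : assocIso l r h t = t + 9 * (r - l) / 16 := by
  rw [assocIso_apply]; grind

theorem assocIso_right {l r : ℝ} (h : l < r) {t : ℝ} (h0 : 3 * l + r ≤ 4 * t) (h1 : t ≤ r) :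
    assocIso l r h t = (t + 3 * r) / 4 := by
  rw [assocIso_apply]; grind

theorem circleHomeo_mapsLinearly {A B : ℝ} (e : ℝ ≃o ℝ) (h0 : e A = B) (h1 : e (A + 1) = B + 1)
    {J K : Interval} (hJ : J.left ≤ J.right) (hA : A ≤ J.left) (hA' : J.right ≤ A + 1)
    (h : ∀ t ∈ Set.Icc (0 : ℝ) 1,
      e (J.left + t * (J.right - J.left)) = K.left + t * (K.right - K.left)) :
    MapsLinearly (circleHomeo A B e h0 h1) J K := by
  intro t ht
  obtain ⟨a, b⟩ := lerp_mem hJ ht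
  rw [circleHomeo_apply e h0 h1 ⟨by linarith, by linarith⟩, h t ht]

theorem exists_isAssociator {J : Interval} (hJ : J.left < J.right) {A : ℝ} (hA : A ≤ J.left)
    (hA' : J.right ≤ A + 1) : ∃ f : UnitAddCircle ≃ₜ UnitAddCircle, IsAssociator f J := by
  obtain ⟨l, r⟩ := J
  simp only at hJ hA hA'
  refine ⟨circleHomeo A A (assocIso l r hJ) (assocIso_out hJ (Or.inl hA))
    (assocIso_out hJ (Or.inr hA')), ?_, ?_, ?_, ?_, ?_, ?_⟩
  · intro z hz
    obtain ⟨x, hx, rfl⟩ : z ∈ ((↑) : ℝ → UnitAddCircle) '' Set.Icc A (A + 1) := by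
      rw [AddCircle.coe_image_Icc_eq]; trivial
    rw [circleHomeo_apply _ _ _ hx, assocIso_out]
    by_contra! hx'
    exact hz ⟨x, hx', rfl⟩
  all_goals
    refine circleHomeo_mapsLinearly _ _ _ ?_ ?_ ?_ fun t ht => ?_
    iterate 3
      simp only [Interval.first, Interval.middle, Interval.last]; linarith
    have h0 := mul_nonneg ht.1 (sub_pos.2 hJ).le
    have h1 := mul_nonneg (sub_nonneg.2 ht.2) (sub_pos.2 hJ).le
  · rw [assocIso_left] <;> simp only [Interval.first] <;> linarith
  · rw [assocIso_left] <;> simp only [Interval.first, Interval.middle] <;> linarith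
  · rw [assocIso_mid] <;> simp only [Interval.first, Interval.last] <;> linarith
  · rw [assocIso_right] <;> simp only [Interval.middle, Interval.last] <;> linarith
  · rw [assocIso_right] <;> simp only [Interval.last] <;> linarith

/-! ### The half turn and the flip -/

/-- The union of the first three base intervals, the complement of the last one. -/
noncomputable def flank : Interval := ⟨1 / 6, 5 / 6⟩

theorem flank_first : flank.first = baseInterval 0 := by
  ext <;> simp [flank, Interval.first, baseInterval]
  norm_num

theorem flank_middle : flank.middle = baseInterval 1 := by
  ext <;> simp [flank, Interval.middle, baseInterval] <;> norm_num

theorem flank_last : flank.last = baseInterval 2 := by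
  ext <;> simp [flank, Interval.last, baseInterval]
  norm_num

theorem flank_lt : flank.left < flank.right := by norm_num [flank]

theorem exists_halfTurn : ∃ f : UnitAddCircle ≃ₜ UnitAddCircle,
    MapsLinearly f (baseInterval 0) (baseInterval 2) ∧
    MapsLinearly f (baseInterval 1) (baseInterval 3) ∧
    MapsLinearly f (baseInterval 2) (baseInterval 0) ∧
    MapsLinearly f (baseInterval 3) (baseInterval 1) := by
  refine ⟨Homeomorph.addRight ((1 / 2 : ℝ) : UnitAddCircle), ?_, ?_, ?_, ?_⟩
  · intro t ht
    simp only [Homeomorph.coe_addRight]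
    rw [← AddCircle.coe_add, coe_real_eq_iff]
    exact ⟨0, by simp [baseInterval]; ring⟩
  · intro t ht
    simp only [Homeomorph.coe_addRight]
    rw [← AddCircle.coe_add, coe_real_eq_iff]
    exact ⟨0, by simp [baseInterval]; ring⟩
  · intro t ht
    simp only [Homeomorph.coe_addRight]
    rw [← AddCircle.coe_add, coe_real_eq_iff]
    exact ⟨1, by simp [baseInterval]; ring⟩
  · intro t ht
    simp only [Homeomorph.coe_addRight]
    rw [← AddCircle.coe_add, coe_real_eq_iff]
    exact ⟨1, by simp [baseInterval]; ring⟩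

/-- The order automorphism of the line underlying the flip. -/
noncomputable def flipIso : ℝ ≃o ℝ :=
  Equiv.toOrderIso
    -- The two branches meet at `5/6`: slope `1/2` takes `[1/6, 5/6]` to `[5/6, 7/6]`, and slope `2`
    -- takes `[5/6, 7/6]` to `[7/6, 11/6]`.
    { toFun := fun t => max (t / 2 + 3 / 4) (2 * t - 1 / 2)
      invFun := fun t => min (2 * t - 3 / 2) (t / 2 + 1 / 4)
      left_inv := by
        intro t
        simp only []
        grind
      right_inv := by
        intro t
        simp only []
        grind }
    (by intro s t hst; simp only [Equiv.coe_fn_mk]; gcongr)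
    (by intro s t hst; simp only [Equiv.coe_fn_symm_mk]; gcongr)

theorem exists_flip : ∃ f : UnitAddCircle ≃ₜ UnitAddCircle,
    MapsLinearly f flank (baseInterval 3) ∧ MapsLinearly f (baseInterval 3) flank := by
  have h : ∀ t, flipIso t = max (t / 2 + 3 / 4) (2 * t - 1 / 2) := fun _ => rfl
  refine ⟨circleHomeo (1 / 6) (5 / 6) flipIso (by rw [h]; norm_num) (by rw [h]; norm_num), ?_, ?_⟩
  · refine circleHomeo_mapsLinearly _ _ _ flank_lt.le (by norm_num [flank]) (by norm_num [flank])
      fun t ht => ?_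
    obtain ⟨h0, h1⟩ := ht
    rw [h, max_eq_left] <;> simp [flank, baseInterval] <;> linarith
  -- On the line the image is `flank` moved by one full turn.
  · have : MapsLinearly (circleHomeo (1 / 6) (5 / 6) flipIso (by rw [h]; norm_num)
        (by rw [h]; norm_num)) (baseInterval 3) ⟨7 / 6, 11 / 6⟩ := by
      refine circleHomeo_mapsLinearly _ _ _ (baseInterval_lt 3).le
        (by simp [baseInterval]; norm_num) (by simp [baseInterval]; norm_num) fun t ht => ?_
      obtain ⟨h0, h1⟩ := ht
      rw [h, max_eq_right] <;> simp [baseInterval] <;> linarith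
    intro t ht
    rw [this t ht, coe_real_eq_iff]
    exact ⟨1, by simp [flank]; ring⟩

/-! ### Carrying subdivisions to each other -/

theorem Carries.interval {f : UnitAddCircle → UnitAddCircle} {J K : Interval}
    (h : MapsLinearly f J K) : Carries f {J} {K} ∅ ∅ :=
  Subdivision.leaf.carries h

/-- With no intervals at all, a single arc becomes a building block, so that diagrams can be
assembled from blocks by `Carries.union`. -/
theorem Carries.arc {f : UnitAddCircle → UnitAddCircle} {z w : Sym2 UnitAddCircle}
    (h : Sym2.map f z = w) : Carries f ∅ ∅ {z} {w} :=
  ⟨fun _ h => h.elim, fun _ h => h.elim, by rw [Set.image_singleton, h]⟩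

theorem MapsLinearly.primaryArc {f : UnitAddCircle → UnitAddCircle} {J K : Interval}
    (h : MapsLinearly f J.middle K.middle) : Sym2.map f J.primaryArc = K.primaryArc := by
  simp only [Interval.primaryArc, Sym2.map_mk, h.left, h.right]

theorem Carries.attach {f : UnitAddCircle → UnitAddCircle} {J K : Interval}
    {s t u s' t' u' : Subdivision} (h : Sym2.map f J.primaryArc = K.primaryArc)
    (hs : Carries f (s.intervals J.first) (s'.intervals K.first) (s.arcs J.first)
      (s'.arcs K.first))
    (ht : Carries f (t.intervals J.middle) (t'.intervals K.middle) (t.arcs J.middle)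
      (t'.arcs K.middle))
    (hu : Carries f (u.intervals J.last) (u'.intervals K.last) (u.arcs J.last)
      (u'.arcs K.last)) :
    Carries f ((Subdivision.attach s t u).intervals J) ((Subdivision.attach s' t' u').intervals K)
      ((Subdivision.attach s t u).arcs J) ((Subdivision.attach s' t' u').arcs K) := by
  have := (Carries.arc h).union ((hs.union ht).union hu)
  rwa [Set.empty_union, Set.empty_union] at this

theorem IsAssociator.carries {f : UnitAddCircle → UnitAddCircle} {J : Interval}
    (h : IsAssociator f J) (s t u t' u' : Subdivision) :
    Carries f ((Subdivision.attach (.attach s t u) t' u').intervals J)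
      ((Subdivision.attach s t (.attach u t' u')).intervals J)
      ((Subdivision.attach (.attach s t u) t' u').arcs J)
      ((Subdivision.attach s t (.attach u t' u')).arcs J) := by
  -- The five pieces keep their order while the two arcs shift: the inner left arc becomes the outer
  -- one, and the outer one becomes the inner right arc.
  have h₀ : Sym2.map f J.first.primaryArc = J.primaryArc := by
    simp only [Interval.primaryArc, Sym2.map_mk, h.map₂.left, h.map₂.right]
  have h₁ : Sym2.map f J.primaryArc = J.last.primaryArc := by
    simp only [Interval.primaryArc, Sym2.map_mk, h.map₄.left, h.map₄.right]
  have := ((((((Carries.arc h₀).union (Carries.arc h₁)).union (s.carries h.map₁)).union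
    (t.carries h.map₂)).union (u.carries h.map₃)).union (t'.carries h.map₄)).union
    (u'.carries h.map₅)
  simp only [Subdivision.intervals, Subdivision.arcs]
  convert this using 1 <;> ext z <;> simp only [Set.mem_union, Set.mem_empty_iff_false] <;> tauto

namespace ArcDiagram

/-- The first three base intervals are the pieces of `flank`, whose primary arc is the initial arc
`{1/3, 2/3}`. A diagram is thus one subdivision on each side of `outerArc`, which turns questions
about diagrams into questions about single ternary trees. -/
theorem intervals_eq_flank (D : ArcDiagram) : D.intervals =
    (Subdivision.attach (D.sub 0) (D.sub 1) (D.sub 2)).intervals flank ∪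
      (D.sub 3).intervals (baseInterval 3) := by
  ext J
  simp only [intervals, Set.mem_iUnion, Subdivision.intervals, Set.mem_union, Fin.exists_fin_succ,
    flank_first, flank_middle, flank_last, IsEmpty.exists_iff, or_false, or_assoc]
  rfl

/-- The arc that separates the last base interval from the others. -/
noncomputable def outerArc : Sym2 UnitAddCircle :=
  s(((1 / 6 : ℝ) : UnitAddCircle), ((5 / 6 : ℝ) : UnitAddCircle))

theorem primaryArc_flank : flank.primaryArc =
    s(((1 / 3 : ℝ) : UnitAddCircle), ((2 / 3 : ℝ) : UnitAddCircle)) := by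
  rw [Interval.primaryArc, flank_middle]
  rfl

theorem arcs_eq_flank (D : ArcDiagram) : D.arcs =
    (Subdivision.attach (D.sub 0) (D.sub 1) (D.sub 2)).arcs flank ∪ {outerArc} ∪
      (D.sub 3).arcs (baseInterval 3) := by
  ext z
  simp only [arcs, Set.mem_iUnion, Subdivision.arcs, Set.mem_union, Fin.exists_fin_succ,
    flank_first, flank_middle, flank_last, IsEmpty.exists_iff, or_false, primaryArc_flank,
    Set.mem_singleton_iff, Set.mem_insert_iff]
  change ((_ ∨ z = outerArc) ∨ _ ∨ _ ∨ _ ∨ z ∈ (D.sub 3).arcs (baseInterval 3)) ↔ _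
  tauto

theorem carried_of_flank {f : UnitAddCircle → UnitAddCircle} {s t u v s' t' u' v' : Subdivision}
    (h : Carries f ((Subdivision.attach s t u).intervals flank)
      ((Subdivision.attach s' t' u').intervals flank)
      ((Subdivision.attach s t u).arcs flank) ((Subdivision.attach s' t' u').arcs flank))
    (h' : Carries f (v.intervals (baseInterval 3)) (v'.intervals (baseInterval 3))
      (v.arcs (baseInterval 3)) (v'.arcs (baseInterval 3)))
    (hf : Sym2.map f outerArc = outerArc) :
    Carried f ⟨![s, t, u, v]⟩ ⟨![s', t', u', v']⟩ := by
  have := (h.union (Carries.arc hf)).union h'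
  rw [Set.union_empty, Set.union_empty] at this
  rw [Carried, intervals_eq_flank, intervals_eq_flank, arcs_eq_flank, arcs_eq_flank]
  exact this

end ArcDiagram

/-! ### The explicit maps belong to the group -/

open ArcDiagram

theorem coe_seven_sixths : ((7 / 6 : ℝ) : UnitAddCircle) = ((1 / 6 : ℝ) : UnitAddCircle) :=
  coe_real_eq_iff.2 ⟨1, by norm_num⟩

theorem outerArc_fixed {f : UnitAddCircle → UnitAddCircle}
    (h : MapsLinearly f (baseInterval 3) (baseInterval 3)) : Sym2.map f outerArc = outerArc := by
  have h1 : f ((5 / 6 : ℝ) : UnitAddCircle) = ((5 / 6 : ℝ) : UnitAddCircle) := h.left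
  have h2 : f ((7 / 6 : ℝ) : UnitAddCircle) = ((7 / 6 : ℝ) : UnitAddCircle) := h.right
  rw [coe_seven_sixths] at h2
  rw [outerArc, Sym2.map_mk, h1, h2]

theorem isAssociator_flank_mem {f : UnitAddCircle ≃ₜ UnitAddCircle} (h : IsAssociator f flank) :
    f ∈ TB := by
  have hd : MapsLinearly f (baseInterval 3) (baseInterval 3) :=
    h.supp.fix_after (baseInterval_lt 3).le le_rfl (by simp [flank, baseInterval]; norm_num)
  exact (isDyadicRearrangement_iff f).2 ⟨_, _, carried_of_flank
    (h.carries .leaf .leaf .leaf .leaf .leaf) (Subdivision.leaf.carries hd) (outerArc_fixed hd)⟩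

theorem isAssociator_base_zero_mem {f : UnitAddCircle ≃ₜ UnitAddCircle}
    (h : IsAssociator f (baseInterval 0)) : f ∈ TB := by
  have fix : ∀ i : Fin 4, 0 < i → MapsLinearly f (baseInterval i) (baseInterval i) := by
    intro i hi
    refine h.supp.fix_after (baseInterval_lt i).le (baseInterval_mono hi) ?_
    have := (baseInterval_mem i).2
    have h0 : (baseInterval 0).left = 1 / 6 := rfl
    linarith
  have h1 : MapsLinearly f flank.middle flank.middle := flank_middle ▸ fix 1 (by decide)
  have h2 : MapsLinearly f flank.last flank.last := flank_last ▸ fix 2 (by decide)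
  have h0 := h.carries .leaf .leaf .leaf .leaf .leaf
  rw [← flank_first] at h0
  exact (isDyadicRearrangement_iff f).2 ⟨_, _, carried_of_flank (Carries.attach h1.primaryArc h0
    (Subdivision.leaf.carries h1) (Subdivision.leaf.carries h2))
    (Subdivision.leaf.carries (fix 3 (by decide))) (outerArc_fixed (fix 3 (by decide)))⟩

theorem halfTurn_mem {f : UnitAddCircle ≃ₜ UnitAddCircle}
    (h0 : MapsLinearly f (baseInterval 0) (baseInterval 2))
    (h1 : MapsLinearly f (baseInterval 1) (baseInterval 3))
    (h2 : MapsLinearly f (baseInterval 2) (baseInterval 0))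
    (h3 : MapsLinearly f (baseInterval 3) (baseInterval 1)) : f ∈ TB := by
  have e0 : f ((1 / 3 : ℝ) : UnitAddCircle) = ((5 / 6 : ℝ) : UnitAddCircle) := h1.left
  have e1 : f ((2 / 3 : ℝ) : UnitAddCircle) = ((1 / 6 : ℝ) : UnitAddCircle) := h2.left
  have e2 : f ((1 / 6 : ℝ) : UnitAddCircle) = ((2 / 3 : ℝ) : UnitAddCircle) := h0.left
  have e3 : f ((5 / 6 : ℝ) : UnitAddCircle) = ((1 / 3 : ℝ) : UnitAddCircle) := h3.left
  -- The half turn exchanges the two initial arcs.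
  have a0 : Sym2.map f flank.primaryArc = outerArc := by
    rw [primaryArc_flank, outerArc, Sym2.map_mk, e0, e1, Sym2.eq_swap]
  have a1 : Sym2.map f outerArc = flank.primaryArc := by
    rw [primaryArc_flank, outerArc, Sym2.map_mk, e2, e3, Sym2.eq_swap]
  have := ((((Carries.interval h0).union (Carries.interval h1)).union
    (Carries.interval h2)).union (Carries.interval h3)).union
    ((Carries.arc a0).union (Carries.arc a1))
  refine (isDyadicRearrangement_iff f).2 ⟨⟨fun _ => .leaf⟩, ⟨fun _ => .leaf⟩, ?_⟩
  rw [Carried, intervals_eq_flank, arcs_eq_flank]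
  simp only [Subdivision.intervals, Subdivision.arcs, flank_first, flank_middle, flank_last]
  convert this using 1 <;> ext z <;>
    simp only [Set.mem_union, Set.mem_empty_iff_false, Set.mem_singleton_iff] <;> tauto

theorem flip_mem {f : UnitAddCircle ≃ₜ UnitAddCircle}
    (h : MapsLinearly f flank (baseInterval 3)) (h' : MapsLinearly f (baseInterval 3) flank) :
    f ∈ TB := by
  have e0 : f ((1 / 6 : ℝ) : UnitAddCircle) = ((5 / 6 : ℝ) : UnitAddCircle) := h.left
  have e1 : f ((5 / 6 : ℝ) : UnitAddCircle) = ((1 / 6 : ℝ) : UnitAddCircle) := h'.left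
  have a : Sym2.map f outerArc = outerArc := by
    rw [outerArc, Sym2.map_mk, e0, e1, Sym2.eq_swap]
  -- The last base interval must receive its primary arc, to match the arc `{1/3, 2/3}` already
  -- present on the side of `flank`.
  have := (((Subdivision.attach .leaf .leaf .leaf).carries h).union
    ((Subdivision.attach .leaf .leaf .leaf).carries h')).union (Carries.arc a)
  refine (isDyadicRearrangement_iff f).2
    ⟨⟨![.leaf, .leaf, .leaf, .attach .leaf .leaf .leaf]⟩,
      ⟨![.leaf, .leaf, .leaf, .attach .leaf .leaf .leaf]⟩, ?_⟩
  rw [Carried, intervals_eq_flank, arcs_eq_flank]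
  change Carries f ((Subdivision.attach .leaf .leaf .leaf).intervals flank ∪
    (Subdivision.attach .leaf .leaf .leaf).intervals (baseInterval 3))
    ((Subdivision.attach .leaf .leaf .leaf).intervals flank ∪
    (Subdivision.attach .leaf .leaf .leaf).intervals (baseInterval 3))
    ((Subdivision.attach .leaf .leaf .leaf).arcs flank ∪ {outerArc} ∪
    (Subdivision.attach .leaf .leaf .leaf).arcs (baseInterval 3))
    ((Subdivision.attach .leaf .leaf .leaf).arcs flank ∪ {outerArc} ∪
    (Subdivision.attach .leaf .leaf .leaf).arcs (baseInterval 3))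
  convert this using 1 <;> ext z <;> simp only [Set.mem_union, Set.mem_empty_iff_false] <;> tauto

/-! ### Words of subdivisions -/

/-- Two subdivisions are rebracketings of each other: they attach the same arcs up to a
reparametrization of the interval. -/
inductive Subdivision.Rebracket : Subdivision → Subdivision → Prop
  | refl (s) : Rebracket s s
  | symm {s t} : Rebracket s t → Rebracket t s
  | trans {s t u} : Rebracket s t → Rebracket t u → Rebracket s u
  | attach {s s' t t' u u'} : Rebracket s s' → Rebracket t t' → Rebracket u u' →
      Rebracket (.attach s t u) (.attach s' t' u')
  | assoc (s t u t' u') :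
      Rebracket (.attach (.attach s t u) t' u') (.attach s t (.attach u t' u'))

/-- The parenthesis word of a subdivision: from left to right, record for each vertex whether it
is the left or the right endpoint of its arc. -/
def Subdivision.word : Subdivision → List Bool
  | .leaf => []
  | .attach s t u => s.word ++ true :: (t.word ++ false :: u.word)

theorem Subdivision.Rebracket.word_eq {s t : Subdivision} (h : s.Rebracket t) :
    s.word = t.word := by
  induction h with
  | refl => rfl
  | symm _ ih => exact ih.symm
  | trans _ _ ih ih' => exact ih.trans ih'
  | attach _ _ _ h1 h2 h3 => simp only [Subdivision.word, h1, h2, h3]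
  | assoc => simp [Subdivision.word]

/-- Repeated use of `assoc` pushes everything before the first opening parenthesis out of the left
branch. In the resulting form the first arc of the word is the root, which makes the word uniquely
readable. -/
theorem Subdivision.eq_leaf_or_rebracket (s : Subdivision) :
    s = .leaf ∨ ∃ t u, s.Rebracket (.attach .leaf t u) := by
  induction s with
  | leaf => exact Or.inl rfl
  | attach s t u hs _ _ =>
    right
    rcases hs with rfl | ⟨a, b, h⟩
    · exact ⟨t, u, .refl _⟩
    · exact ⟨a, .attach b t u, (Rebracket.attach h (.refl t) (.refl u)).trans (.assoc ..)⟩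

/-- Unique parsing from the left: a word stops where no further parenthesis opens, so the remainders
`x`, `x'` must not begin with an opening one. Carrying remainders along is what lets the induction
separate the inside of the first arc from what follows it. -/
theorem Subdivision.rebracket_of_word_append (n : ℕ) : ∀ (s s' : Subdivision) (x x' : List Bool),
    s.word.length ≤ n → (∀ y, x ≠ true :: y) → (∀ y, x' ≠ true :: y) →
    s.word ++ x = s'.word ++ x' → s.Rebracket s' ∧ x = x' := by
  induction n with
  | zero =>
    intro s s' x x' hn hx hx' h
    rcases s.eq_leaf_or_rebracket with rfl | ⟨t, u, hs⟩
    · rcases s'.eq_leaf_or_rebracket with rfl | ⟨t', u', hs'⟩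
      · exact ⟨.refl _, h⟩
      · rw [hs'.word_eq] at h
        exact absurd h (hx _)
    · rw [hs.word_eq] at hn
      simp [word] at hn
  | succ n ih =>
    intro s s' x x' hn hx hx' h
    rcases s.eq_leaf_or_rebracket with rfl | ⟨t, u, hs⟩
    · rcases s'.eq_leaf_or_rebracket with rfl | ⟨t', u', hs'⟩
      · exact ⟨.refl _, h⟩
      · rw [hs'.word_eq] at h
        exact absurd h (hx _)
    · rw [hs.word_eq] at hn h
      rcases s'.eq_leaf_or_rebracket with rfl | ⟨t', u', hs'⟩
      · exact absurd h.symm (hx' _)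
      · rw [hs'.word_eq] at h
        simp only [word, List.nil_append, List.length_cons, List.length_append, List.cons_append,
          List.append_assoc, List.cons.injEq, true_and] at hn h
        -- The inside of the first arc is followed by its closing parenthesis `false`, so the
        -- conditions on the remainders hold.
        obtain ⟨h1, h2⟩ := ih t t' _ _ (by omega) (by simp) (by simp) h
        obtain ⟨h3, h4⟩ := ih u u' x x' (by omega) hx hx' (List.cons.inj h2).2
        exact ⟨(hs.trans (.attach (.refl _) h1 h3)).trans hs'.symm, h4⟩

theorem Subdivision.rebracket_of_word {s s' : Subdivision} (h : s.word = s'.word) :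
    s.Rebracket s' :=
  (rebracket_of_word_append _ s s' [] [] le_rfl (by simp) (by simp) (by simpa using h)).1

/-! ### Ordered lists of intervals -/

/-- The intervals into which `I` is divided, from left to right. -/
noncomputable def Subdivision.list : Subdivision → Interval → List Interval
  | .leaf, I => [I]
  | .attach s t u, I => s.list I.first ++ (t.list I.middle ++ u.list I.last)

theorem Subdivision.mem_list (s : Subdivision) : ∀ {I J : Interval},
    J ∈ s.list I ↔ J ∈ s.intervals I := by
  induction s with
  | leaf => intro I J; exact List.mem_singleton
  | attach s t u hs ht hu =>
    intro I J
    simp only [list, List.mem_append, hs, ht, hu, intervals, Set.mem_union, or_assoc]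

/-- `f` carries the subdivision `s` of `J` to the subdivision `s'` of `K`, in order. -/
def CarriesInOrder (f : UnitAddCircle → UnitAddCircle) (s : Subdivision) (J : Interval)
    (s' : Subdivision) (K : Interval) : Prop :=
  List.Forall₂ (MapsLinearly f) (s.list J) (s'.list K)

theorem MapsLinearly.carriesInOrder {f : UnitAddCircle → UnitAddCircle} (s : Subdivision) :
    ∀ {J K : Interval}, MapsLinearly f J K → CarriesInOrder f s J s K := by
  induction s with
  | leaf => intro J K h; exact .cons h .nil
  | attach s t u hs ht hu =>
    intro J K h
    exact List.rel_append (hs h.first) (List.rel_append (ht h.middle) (hu h.last))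

theorem CarriesInOrder.attach {f : UnitAddCircle → UnitAddCircle} {J K : Interval}
    {s t u s' t' u' : Subdivision} (hs : CarriesInOrder f s J.first s' K.first)
    (ht : CarriesInOrder f t J.middle t' K.middle) (hu : CarriesInOrder f u J.last u' K.last) :
    CarriesInOrder f (.attach s t u) J (.attach s' t' u') K :=
  List.rel_append hs (List.rel_append ht hu)

theorem IsAssociator.carriesInOrder {f : UnitAddCircle → UnitAddCircle} {J : Interval}
    (h : IsAssociator f J) (s t u t' u' : Subdivision) :
    CarriesInOrder f (.attach (.attach s t u) t' u') J (.attach s t (.attach u t' u')) J := by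
  have := List.rel_append (h.map₁.carriesInOrder s) (List.rel_append (h.map₂.carriesInOrder t)
    (List.rel_append (h.map₃.carriesInOrder u) (List.rel_append (h.map₄.carriesInOrder t')
      (h.map₅.carriesInOrder u'))))
  simpa only [CarriesInOrder, Subdivision.list, List.append_assoc] using this

theorem forall₂_comp {α β γ : Type*} {r : α → β → Prop} {p : β → γ → Prop}
    {q : α → γ → Prop} (hq : ∀ a b c, r a b → p b c → q a c) {l₁ : List α} {l₂ : List β}
    {l₃ : List γ} (h : List.Forall₂ r l₁ l₂) (h' : List.Forall₂ p l₂ l₃) :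
    List.Forall₂ q l₁ l₃ := by
  induction h generalizing l₃ with
  | nil => cases h'; exact .nil
  | cons hab _ ih => cases h' with | cons hbc h' => exact .cons (hq _ _ _ hab hbc) (ih h')

theorem CarriesInOrder.mul {f g : UnitAddCircle ≃ₜ UnitAddCircle} {s t u : Subdivision}
    {J K L : Interval} (hg : CarriesInOrder g t K u L) (hf : CarriesInOrder f s J t K) :
    CarriesInOrder (g * f : _ ≃ₜ _) s J u L :=
  forall₂_comp (fun _ _ _ h h' => h'.mul h) hf hg

theorem CarriesInOrder.inv {f : UnitAddCircle ≃ₜ UnitAddCircle} {s t : Subdivision}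
    {J K : Interval} (hf : CarriesInOrder f s J t K) :
    CarriesInOrder (f⁻¹ : _ ≃ₜ _) t K s J :=
  (List.Forall₂.imp (fun _ _ h => MapsLinearly.inv h) hf).flip

theorem Subdivision.exists_mem_Ico (s : Subdivision) : ∀ {I : Interval} {x : ℝ},
    I.left ≤ x → x < I.right → ∃ J ∈ s.intervals I, J.left ≤ x ∧ x < J.right := by
  induction s with
  | leaf => intro I x h1 h2; exact ⟨I, rfl, h1, h2⟩
  | attach s t u hs ht hu =>
    intro I x h1 h2
    rcases lt_or_ge x I.first.right with h | h
    · obtain ⟨J, hJ, h⟩ := hs (I := I.first) h1 h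
      exact ⟨J, Or.inl (Or.inl hJ), h⟩
    rcases lt_or_ge x I.middle.right with h' | h'
    · obtain ⟨J, hJ, h⟩ := ht (I := I.middle) h h'
      exact ⟨J, Or.inl (Or.inr hJ), h⟩
    · obtain ⟨J, hJ, h⟩ := hu (I := I.last) h' h2
      exact ⟨J, Or.inr hJ, h⟩

theorem MapsLinearly.eq_of_mem {f g : UnitAddCircle → UnitAddCircle} {J K : Interval}
    (hf : MapsLinearly f J K) (hg : MapsLinearly g J K) (hJ : J.left < J.right) {x : ℝ}
    (h1 : J.left ≤ x) (h2 : x ≤ J.right) : f (x : UnitAddCircle) = g (x : UnitAddCircle) := by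
  have hw : 0 < J.right - J.left := by linarith
  have ht : (x - J.left) / (J.right - J.left) ∈ Set.Icc (0 : ℝ) 1 :=
    ⟨div_nonneg (by linarith) hw.le, (div_le_one hw).2 (by linarith)⟩
  have e := (hf _ ht).trans (hg _ ht).symm
  rwa [div_mul_cancel₀ _ hw.ne', add_sub_cancel] at e

theorem exists_of_forall₂_mem {α β : Type*} {r r' : α → β → Prop} {l : List α} {l' : List β}
    (h : List.Forall₂ r l l') (h' : List.Forall₂ r' l l') {a : α} (ha : a ∈ l) :
    ∃ b, r a b ∧ r' a b := by
  induction h with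
  | nil => cases ha
  | cons h0 _ ih =>
    cases h' with
    | cons h0' h' =>
      rcases List.mem_cons.1 ha with rfl | ha
      · exact ⟨_, h0, h0'⟩
      · exact ih h' ha

/-- The subdivisions prescribe which piece goes linearly to which, and this fixes the values inside
`J`; outside both maps are the identity. -/
theorem CarriesInOrder.eq_of_supportedOn {f g : UnitAddCircle ≃ₜ UnitAddCircle}
    {s t : Subdivision} {J K : Interval} (hJ : J.left < J.right) (hf : CarriesInOrder f s J t K)
    (hg : CarriesInOrder g s J t K) (hf' : SupportedOn f J) (hg' : SupportedOn g J) : f = g := by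
  ext z
  by_cases hz : z ∈ J.openArc
  · obtain ⟨x, ⟨h1, h2⟩, rfl⟩ := hz
    obtain ⟨L, hL, h3, h4⟩ := s.exists_mem_Ico h1.le h2
    obtain ⟨M, hM, hM'⟩ := exists_of_forall₂_mem hf hg (s.mem_list.2 hL)
    exact hM.eq_of_mem hM' (s.bounds J hJ L hL).2.1 h3 h4.le
  · rw [hf' z hz, hg' z hz]

/-- The pentagon relation. -/
theorem IsAssociator.pentagon {f f₁ f₂ : UnitAddCircle ≃ₜ UnitAddCircle} {J : Interval}
    (hJ : J.left < J.right) (hJ' : J.right ≤ J.left + 1) (hf : IsAssociator f J)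
    (hf₁ : IsAssociator f₁ J.first) (hf₂ : IsAssociator f₂ J.last) :
    f * f = f₂ * f * f₁ := by
  have s₁ : SupportedOn f₁ J :=
    hf₁.supp.mono le_rfl (by simp only [Interval.first]; linarith)
  have s₂ : SupportedOn f₂ J :=
    hf₂.supp.mono (by simp only [Interval.last]; linarith) le_rfl
  have m₁ : MapsLinearly f₁ J.middle J.middle := hf₁.supp.fix_after
    (Interval.middle_lt hJ).le le_rfl (by simp only [Interval.first, Interval.middle]; linarith)
  have l₁ : MapsLinearly f₁ J.last J.last := hf₁.supp.fix_after (Interval.last_lt hJ).le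
    (by simp only [Interval.first, Interval.last]; linarith)
    (by simp only [Interval.first, Interval.last]; linarith)
  have m₂ : MapsLinearly f₂ J.middle J.middle := hf₂.supp.fix_before
    (Interval.middle_lt hJ).le le_rfl (by simp only [Interval.last, Interval.middle]; linarith)
  have i₂ : MapsLinearly f₂ J.first J.first := hf₂.supp.fix_before (Interval.first_lt hJ).le
    (by simp only [Interval.first, Interval.last]; linarith)
    (by simp only [Interval.first, Interval.last]; linarith)
  -- Both sides of the relation carry the left comb with three arcs to the right comb: `f * f`
  -- through the balanced tree, the other product through the two trees with a zigzag. Agreement on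
  -- the seven pieces gives equality.
  have a := (hf.carriesInOrder .leaf .leaf .leaf .leaf (.attach .leaf .leaf .leaf)).mul
    (hf.carriesInOrder (.attach .leaf .leaf .leaf) .leaf .leaf .leaf .leaf)
  have b₁ := (hf₁.carriesInOrder .leaf .leaf .leaf .leaf .leaf).attach
    (m₁.carriesInOrder .leaf) (l₁.carriesInOrder .leaf)
  have b₂ := (i₂.carriesInOrder .leaf).attach (m₂.carriesInOrder .leaf)
    (hf₂.carriesInOrder .leaf .leaf .leaf .leaf .leaf)
  have b := (b₂.mul (hf.carriesInOrder _ _ _ _ _)).mul b₁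
  exact a.eq_of_supportedOn hJ b (hf.supp.mul hf.supp) ((s₂.mul hf.supp).mul s₁)

/-! ### Colours of intervals -/

/-- The colour of an interval of an arc diagram, the parity of `log₂` of (six times) its width. It
is the parity of the distance of the adjacent region from the central one. -/
def Colour (J : Interval) (c : ZMod 2) : Prop :=
  ∃ n : ℤ, (n : ZMod 2) = c ∧ J.right - J.left = 2 ^ n / 6

theorem Colour.first {J : Interval} {c : ZMod 2} (h : Colour J c) : Colour J.first c := by
  obtain ⟨n, hn, hw⟩ := h
  refine ⟨n - 2, ?_, ?_⟩
  · rw [Int.cast_sub, hn, sub_eq_self]; rfl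
  · rw [zpow_sub₀ two_ne_zero]
    simp only [Interval.first]; norm_num; linarith

theorem Colour.middle {J : Interval} {c : ZMod 2} (h : Colour J c) : Colour J.middle (c + 1) := by
  obtain ⟨n, hn, hw⟩ := h
  refine ⟨n - 1, ?_, ?_⟩
  · rw [Int.cast_sub, hn, CharTwo.sub_eq_add]; simp
  · rw [zpow_sub₀ two_ne_zero]
    simp only [Interval.middle]; norm_num; linarith

theorem Colour.last {J : Interval} {c : ZMod 2} (h : Colour J c) : Colour J.last c := by
  obtain ⟨n, hn, hw⟩ := h
  refine ⟨n - 2, ?_, ?_⟩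
  · rw [Int.cast_sub, hn, sub_eq_self]; rfl
  · rw [zpow_sub₀ two_ne_zero]
    simp only [Interval.last]; norm_num; linarith

theorem colour_baseInterval (i : Fin 4) : Colour (baseInterval i) (i : ℕ) := by
  fin_cases i
  · exact ⟨0, by simp, by simp [baseInterval]; norm_num⟩
  · exact ⟨1, by simp, by simp [baseInterval]; norm_num⟩
  · exact ⟨0, by decide, by simp [baseInterval]; norm_num⟩
  · exact ⟨1, by decide, by simp [baseInterval]; norm_num⟩

theorem Subdivision.exists_left_colour (s : Subdivision) : ∀ {I : Interval} {c : ZMod 2},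
    Colour I c → ∃ J ∈ s.intervals I, J.left = I.left ∧ Colour J c := by
  induction s with
  | leaf => exact fun h => ⟨_, rfl, rfl, h⟩
  | attach s t u hs _ _ =>
    intro I c h
    obtain ⟨J, hJ, h⟩ := hs h.first
    exact ⟨J, Or.inl (Or.inl hJ), h⟩

/-- The outermost pieces of a subdivision keep the colour of the whole interval, since passing to
`first` or `last` divides the width by `4`. Hence colours alternate at each joint of `first`,
`middle`, `last` as they do one level up. -/
theorem Subdivision.colour_succ (s : Subdivision) : ∀ {I : Interval} {c : ZMod 2}, Colour I c →
    ∀ J ∈ s.intervals I, (J.right = I.right ∧ Colour J c) ∨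
      ∃ K ∈ s.intervals I, J.right = K.left ∧ ∃ e, Colour J e ∧ Colour K (e + 1) := by
  induction s with
  | leaf => rintro I c h J rfl; exact Or.inl ⟨rfl, h⟩
  | attach s t u hs ht hu =>
    rintro I c h J ((hJ | hJ) | hJ)
    · right
      rcases hs h.first J hJ with ⟨h1, h2⟩ | ⟨K, hK, h1⟩
      · obtain ⟨K, hK, h3, h4⟩ := t.exists_left_colour h.middle
        exact ⟨K, Or.inl (Or.inr hK), h1.trans h3.symm, c, h2, h4⟩
      · exact ⟨K, Or.inl (Or.inl hK), h1⟩
    · right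
      rcases ht h.middle J hJ with ⟨h1, h2⟩ | ⟨K, hK, h1⟩
      · obtain ⟨K, hK, h3, h4⟩ := u.exists_left_colour h.last
        refine ⟨K, Or.inr hK, h1.trans h3.symm, c + 1, h2, ?_⟩
        rwa [add_assoc, CharTwo.add_self_eq_zero, add_zero]
      · exact ⟨K, Or.inl (Or.inr hK), h1⟩
    · rcases hu h.last J hJ with h1 | ⟨K, hK, h1⟩
      · exact Or.inl h1
      · exact Or.inr ⟨K, Or.inr hK, h1⟩

theorem coe_baseInterval_right (i : Fin 4) :
    ((baseInterval i).right : UnitAddCircle) = ((baseInterval (i + 1)).left : UnitAddCircle) := by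
  fin_cases i
  · rfl
  · rfl
  · rfl
  · exact coe_seven_sixths

namespace ArcDiagram

theorem mem_intervals {D : ArcDiagram} {J : Interval} (i : Fin 4)
    (h : J ∈ (D.sub i).intervals (baseInterval i)) : J ∈ D.intervals :=
  Set.mem_iUnion.2 ⟨i, h⟩

/-- The colours of the intervals of an arc diagram alternate around the circle. -/
theorem colour_succ (D : ArcDiagram) {J : Interval} (hJ : J ∈ D.intervals) :
    ∃ K ∈ D.intervals, (J.right : UnitAddCircle) = (K.left : UnitAddCircle) ∧
      ∃ e, Colour J e ∧ Colour K (e + 1) := by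
  obtain ⟨i, hi⟩ := Set.mem_iUnion.1 hJ
  rcases (D.sub i).colour_succ (colour_baseInterval i) J hi with ⟨h1, h2⟩ | ⟨K, hK, h1, h2⟩
  · obtain ⟨K, hK, h3, h4⟩ := (D.sub (i + 1)).exists_left_colour (colour_baseInterval (i + 1))
    refine ⟨K, mem_intervals _ hK, ?_, _, h2, ?_⟩
    · rw [h1, h3, coe_baseInterval_right]
    · convert h4 using 1
      fin_cases i <;> decide
  · exact ⟨K, mem_intervals _ hK, by rw [h1], h2⟩

end ArcDiagram

theorem Subdivision.exists_right (s : Subdivision) : ∀ I : Interval,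
    ∃ J ∈ s.intervals I, J.right = I.right := by
  induction s with
  | leaf => exact fun I => ⟨I, rfl, rfl⟩
  | attach s t u _ _ hu =>
    intro I
    obtain ⟨J, hJ, h⟩ := hu I.last
    exact ⟨J, Or.inr hJ, h⟩

/-- Induction along the circle: a property inherited by the next interval spreads from the leftmost
piece to all pieces. -/
theorem Subdivision.forall_of_succ (s : Subdivision) {A : Set Interval} {P : Interval → Prop}
    (hP : ∀ J ∈ A, ∀ K ∈ A, (J.right : UnitAddCircle) = (K.left : UnitAddCircle) → P J → P K) :
    ∀ I : Interval, s.intervals I ⊆ A → (∀ J ∈ s.intervals I, J.left = I.left → P J) →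
      ∀ J ∈ s.intervals I, P J := by
  induction s with
  | leaf => rintro I - h J rfl; exact h J rfl rfl
  | attach s t u hs ht hu =>
    intro I hA h
    have h1 := hs I.first (fun J hJ => hA (Or.inl (Or.inl hJ)))
      fun J hJ e => h J (Or.inl (Or.inl hJ)) e
    obtain ⟨K, hK, eK⟩ := s.exists_right I.first
    have h2 := ht I.middle (fun J hJ => hA (Or.inl (Or.inr hJ))) fun J hJ e =>
      hP K (hA (Or.inl (Or.inl hK))) J (hA (Or.inl (Or.inr hJ))) (by rw [eK, e]; rfl) (h1 K hK)
    obtain ⟨L, hL, eL⟩ := t.exists_right I.middle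
    have h3 := hu I.last (fun J hJ => hA (Or.inr hJ)) fun J hJ e =>
      hP L (hA (Or.inl (Or.inr hL))) J (hA (Or.inr hJ)) (by rw [eL, e]; rfl) (h2 L hL)
    rintro J ((hJ | hJ) | hJ)
    exacts [h1 J hJ, h2 J hJ, h3 J hJ]

theorem ArcDiagram.forall_of_succ (D : ArcDiagram) {P : Interval → Prop}
    (hP : ∀ J ∈ D.intervals, ∀ K ∈ D.intervals,
      (J.right : UnitAddCircle) = (K.left : UnitAddCircle) → P J → P K)
    (h : ∀ J ∈ D.intervals, J.left = (baseInterval 0).left → P J) : ∀ J ∈ D.intervals, P J := by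
  have step : ∀ i, (∀ J ∈ (D.sub i).intervals (baseInterval i),
      J.left = (baseInterval i).left → P J) → ∀ J ∈ (D.sub i).intervals (baseInterval i), P J :=
    fun i => (D.sub i).forall_of_succ hP _ fun J hJ => mem_intervals i hJ
  have next : ∀ i, (∀ J ∈ (D.sub i).intervals (baseInterval i), P J) →
      ∀ J ∈ (D.sub (i + 1)).intervals (baseInterval (i + 1)), P J := by
    intro i hi
    refine step _ fun J hJ e => ?_
    obtain ⟨K, hK, eK⟩ := (D.sub i).exists_right (baseInterval i)
    exact hP K (mem_intervals i hK) J (mem_intervals _ hJ)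
      (by rw [eK, e, coe_baseInterval_right]) (hi K hK)
  have h0 := step 0 fun J hJ e => h J (mem_intervals 0 hJ) e
  have h1 := next 0 h0
  have h2 := next 1 h1
  have h3 := next 2 h2
  intro J hJ
  obtain ⟨i, hi⟩ := Set.mem_iUnion.1 hJ
  fin_cases i
  exacts [h0 J hi, h1 J hi, h2 J hi, h3 J hi]

theorem Colour.unique {J : Interval} {c e : ZMod 2} (h : Colour J c) (h' : Colour J e) :
    c = e := by
  obtain ⟨n, rfl, hn⟩ := h
  obtain ⟨m, rfl, hm⟩ := h'
  have : (2 : ℝ) ^ n = 2 ^ m := by linarith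
  rw [zpow_right_injective₀ two_pos (by norm_num) this]

/-- A dyadic rearrangement either preserves all colours or changes all of them. -/
theorem ArcDiagram.Carried.exists_colour_shift {f : UnitAddCircle → UnitAddCircle}
    {D R : ArcDiagram} (h : Carried f D R) : ∃ c : ZMod 2, ∀ J ∈ D.intervals,
      ∃ K, MapsLinearly f J K ∧ ∃ e, Colour J e ∧ Colour K (e + c) := by
  obtain ⟨J₀, hJ₀, eJ₀, cJ₀⟩ := (D.sub 0).exists_left_colour (colour_baseInterval 0)
  obtain ⟨K₀, hK₀, l₀⟩ := h.fwd J₀ (mem_intervals 0 hJ₀)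
  -- Used only to give `K₀` a colour. The shift is then read off at the leftmost piece of the first
  -- base interval and propagated by alternation in `D` and in `R`.
  obtain ⟨-, -, -, e₀, cK₀, -⟩ := R.colour_succ hK₀
  refine ⟨e₀ - ((0 : Fin 4) : ℕ), fun J hJ => ?_⟩
  suffices ∀ J ∈ D.intervals, ∃ K ∈ R.intervals, MapsLinearly f J K ∧ ∃ e, Colour J e ∧
      Colour K (e + (e₀ - ((0 : Fin 4) : ℕ))) by
    obtain ⟨K, -, h⟩ := this J hJ
    exact ⟨K, h⟩
  refine D.forall_of_succ ?_ ?_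
  · rintro J hJ J' hJ' hs ⟨K, hK, l, e, c1, c2⟩
    obtain ⟨J'', hJ'', a, i, ci, ci'⟩ := D.colour_succ hJ
    obtain rfl := D.eq_of_coe_left hJ' hJ'' (hs.symm.trans a)
    obtain ⟨K', hK', b, j, cj, cj'⟩ := R.colour_succ hK
    obtain ⟨K'', hK'', l'⟩ := h.fwd J' hJ'
    have : K'' = K' := R.eq_of_coe_left hK'' hK' (by rw [← l'.left, ← hs, l.right, b])
    subst this
    refine ⟨K'', hK'', l', i + 1, ci', ?_⟩
    rw [ci.unique c1, add_right_comm, c2.unique cj]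
    exact cj'
  · intro J hJ e
    obtain rfl := D.eq_of_coe_left hJ (mem_intervals 0 hJ₀) (by rw [e, eJ₀])
    exact ⟨K₀, hK₀, l₀, _, cJ₀, by rwa [add_sub_cancel]⟩

/-! ### The parity homomorphism -/

/-- To the right of `p`, the map `f` is linear with slope `2 ^ m`. -/
def HasRightSlope (f : UnitAddCircle → UnitAddCircle) (p : ℝ) (m : ℤ) : Prop :=
  ∃ ε > 0, ∃ y : ℝ, ∀ t, 0 ≤ t → t ≤ ε → f ((p + t : ℝ) : UnitAddCircle) =
    ((y + 2 ^ m * t : ℝ) : UnitAddCircle)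

theorem HasRightSlope.unique {f : UnitAddCircle → UnitAddCircle} {p : ℝ} {m n : ℤ}
    (h : HasRightSlope f p m) (h' : HasRightSlope f p n) : m = n := by
  obtain ⟨ε, hε, y, h⟩ := h
  obtain ⟨ε', hε', y', h'⟩ := h'
  have hm : (0 : ℝ) < 2 ^ m := by positivity
  have hn : (0 : ℝ) < 2 ^ n := by positivity
  -- For `t` this small the lifted images move by less than a full turn, so the integer by which the
  -- two lifts differ cannot change between `0` and `t`.
  obtain ⟨t, ht, h1, h2, h3, h4⟩ : ∃ t : ℝ, 0 < t ∧ t ≤ ε ∧ t ≤ ε' ∧ 2 ^ m * t < 1 ∧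
      2 ^ n * t < 1 := by
    refine ⟨min (min ε ε') (1 / (2 ^ m + 2 ^ n)), by positivity,
      (min_le_left _ _).trans (min_le_left _ _), (min_le_left _ _).trans (min_le_right _ _), ?_, ?_⟩
    · refine (mul_le_mul_of_nonneg_left (min_le_right _ _) hm.le).trans_lt ?_
      rw [mul_one_div, div_lt_one (by positivity)]; linarith
    · refine (mul_le_mul_of_nonneg_left (min_le_right _ _) hn.le).trans_lt ?_
      rw [mul_one_div, div_lt_one (by positivity)]; linarith
  obtain ⟨i, hi⟩ := coe_real_eq_iff.1 ((h 0 le_rfl hε.le).symm.trans (h' 0 le_rfl hε'.le))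
  obtain ⟨j, hj⟩ := coe_real_eq_iff.1 ((h t ht.le h1).symm.trans (h' t ht.le h2))
  have h5 : 0 < 2 ^ m * t := by positivity
  have h6 : 0 < 2 ^ n * t := by positivity
  have h7 : ((j - i : ℤ) : ℝ) < 1 := by push_cast; linarith
  have h8 : ((-1 : ℤ) : ℝ) < ((j - i : ℤ) : ℝ) := by push_cast; linarith
  have h9 : j = i := by
    have := Int.cast_lt.1 h8
    have : j - i < 1 := by exact_mod_cast h7
    omega
  subst h9
  have : (2 : ℝ) ^ m * t = 2 ^ n * t := by linarith
  exact zpow_right_injective₀ two_pos (by norm_num) (mul_right_cancel₀ ht.ne' this)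

theorem MapsLinearly.hasRightSlope {f : UnitAddCircle → UnitAddCircle} {J K : Interval}
    (h : MapsLinearly f J K) {m : ℤ} (hw : K.right - K.left = 2 ^ m * (J.right - J.left)) {p : ℝ}
    (h1 : J.left ≤ p) (h2 : p < J.right) : HasRightSlope f p m := by
  have hJ : 0 < J.right - J.left := by linarith
  refine ⟨J.right - p, by linarith, K.left + 2 ^ m * (p - J.left), fun t h3 h4 => ?_⟩
  have ht : (p + t - J.left) / (J.right - J.left) ∈ Set.Icc (0 : ℝ) 1 :=
    ⟨div_nonneg (by linarith) hJ.le, (div_le_one hJ).2 (by linarith)⟩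
  have := h _ ht
  rw [div_mul_cancel₀ _ hJ.ne', add_sub_cancel, hw] at this
  rw [this]
  congr 1
  field_simp
  ring

/-- `f` is everywhere linear to the right, with slopes that are powers of two whose exponents have
parity `c`. -/
def HasParity (f : UnitAddCircle → UnitAddCircle) (c : ZMod 2) : Prop :=
  ∀ p : ℝ, ∃ m : ℤ, (m : ZMod 2) = c ∧ HasRightSlope f p m

theorem HasParity.unique {f : UnitAddCircle → UnitAddCircle} {c e : ZMod 2}
    (h : HasParity f c) (h' : HasParity f e) : c = e := by
  obtain ⟨m, rfl, hm⟩ := h 0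
  obtain ⟨n, rfl, hn⟩ := h' 0
  rw [hm.unique hn]

theorem HasParity.comp {f g : UnitAddCircle → UnitAddCircle} {c e : ZMod 2}
    (hg : HasParity g e) (hf : HasParity f c) : HasParity (g ∘ f) (e + c) := by
  intro p
  obtain ⟨m, rfl, ε, hε, y, h⟩ := hf p
  obtain ⟨n, rfl, ε', hε', y', h'⟩ := hg y
  have hm : (0 : ℝ) < 2 ^ m := by positivity
  refine ⟨n + m, by push_cast; rfl, min ε (ε' / 2 ^ m), by positivity, y', fun t h1 h2 => ?_⟩
  rw [Function.comp_apply, h t h1 (h2.trans (min_le_left _ _)), h' _ (by positivity),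
    zpow_add₀ two_ne_zero, mul_assoc]
  rw [← le_div_iff₀' hm]
  exact h2.trans (min_le_right _ _)

/-- The slope from a piece of colour `i` to its image of colour `j` is `2 ^ (j - i)`, so its parity
is the common colour shift. Right slopes suffice because each point lies in a half-open piece
`[left, right)`. -/
theorem exists_hasParity {f : UnitAddCircle ≃ₜ UnitAddCircle} (hf : f ∈ TB) :
    ∃ c, HasParity f c := by
  obtain ⟨D, R, h⟩ := (isDyadicRearrangement_iff f).1 hf
  obtain ⟨c, hc⟩ := h.exists_colour_shift
  refine ⟨c, fun p => ?_⟩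
  obtain ⟨q, n, h1, h2, hq⟩ : ∃ q : ℝ, ∃ n : ℤ, 1 / 6 ≤ q ∧ q < 7 / 6 ∧ p = q + n := by
    refine ⟨Int.fract (p - 1 / 6) + 1 / 6, ⌊p - 1 / 6⌋, ?_, ?_, ?_⟩
    · linarith [Int.fract_nonneg (p - 1 / 6)]
    · linarith [Int.fract_lt_one (p - 1 / 6)]
    · linarith [Int.fract_add_floor (p - 1 / 6)]
  suffices ∃ m : ℤ, (m : ZMod 2) = c ∧ HasRightSlope f q m by
    obtain ⟨m, hm, ε, hε, y, h⟩ := this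
    refine ⟨m, hm, ε, hε, y, fun t h1 h2 => ?_⟩
    rw [← h t h1 h2]
    exact congrArg f (coe_real_eq_iff.2 ⟨n, by rw [hq]; ring⟩)
  obtain ⟨J, hJ, h3, h4⟩ : ∃ J ∈ D.intervals, J.left ≤ q ∧ q < J.right := by
    obtain ⟨i, hi⟩ : ∃ i : Fin 4, (baseInterval i).left ≤ q ∧ q < (baseInterval i).right := by
      rcases lt_or_ge q (1 / 3) with a | a
      · exact ⟨0, h1, a⟩
      rcases lt_or_ge q (2 / 3) with b | b
      · exact ⟨1, a, b⟩
      rcases lt_or_ge q (5 / 6) with a | a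
      · exact ⟨2, b, a⟩
      · exact ⟨3, a, h2⟩
    obtain ⟨J, hJ, h⟩ := (D.sub i).exists_mem_Ico hi.1 hi.2
    exact ⟨J, ArcDiagram.mem_intervals i hJ, h⟩
  obtain ⟨K, l, e, ⟨i, rfl, wi⟩, ⟨j, hj, wj⟩⟩ := hc J hJ
  refine ⟨j - i, by rw [Int.cast_sub, hj, add_sub_cancel_left], l.hasRightSlope ?_ h3 h4⟩
  rw [wi, wj, zpow_sub₀ two_ne_zero]
  field_simp

/-- The parity of a dyadic rearrangement. -/
noncomputable def parity : TB →* Multiplicative (ZMod 2) :=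
  MonoidHom.mk' (fun f => Multiplicative.ofAdd (exists_hasParity f.2).choose) fun g f =>
    congrArg Multiplicative.ofAdd ((exists_hasParity (g * f).2).choose_spec.unique
      ((exists_hasParity g.2).choose_spec.comp (exists_hasParity f.2).choose_spec))

theorem parity_of_hasRightSlope {f : TB} {p : ℝ} {m : ℤ} (h : HasRightSlope f.1 p m) :
    parity f = Multiplicative.ofAdd (m : ZMod 2) := by
  obtain ⟨n, hn, h'⟩ := (exists_hasParity f.2).choose_spec p
  rw [h.unique h', hn]
  rfl

/-! ### Walking along the intervals of a subdivision -/

/-- The intervals of `l` follow each other, leading from `x` to `y`. -/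
def IsPath : ℝ → List Interval → ℝ → Prop
  | x, [], y => x = y
  | x, J :: l, y => J.left = x ∧ J.left < J.right ∧ IsPath J.right l y

theorem IsPath.append {x y z : ℝ} {l l' : List Interval} (h : IsPath x l y) (h' : IsPath y l' z) :
    IsPath x (l ++ l') z := by
  induction l generalizing x with
  | nil => obtain rfl : x = y := h; exact h'
  | cons J l ih => exact ⟨h.1, h.2.1, ih h.2.2⟩

theorem IsPath.le {x y : ℝ} {l : List Interval} (h : IsPath x l y) : x ≤ y := by
  induction l generalizing x with
  | nil => exact le_of_eq h
  | cons J l ih => linarith [ih h.2.2, h.1, h.2.1]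

theorem IsPath.le_left {x y : ℝ} {l : List Interval} (h : IsPath x l y) :
    ∀ J ∈ l, x ≤ J.left := by
  induction l generalizing x with
  | nil => simp
  | cons J l ih =>
    intro K hK
    rcases List.mem_cons.1 hK with rfl | hK
    · exact h.1.ge
    · linarith [ih h.2.2 K hK, h.1, h.2.1]

theorem IsPath.pairwise {x y : ℝ} {l : List Interval} (h : IsPath x l y) :
    (l.map Interval.left).Pairwise (· < ·) := by
  induction l generalizing x with
  | nil => exact .nil
  | cons J l ih =>
    refine List.pairwise_cons.2 ⟨?_, ih h.2.2⟩
    intro v hv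
    obtain ⟨K, hK, rfl⟩ := List.mem_map.1 hv
    exact h.2.1.trans_le (h.2.2.le_left K hK)

theorem Subdivision.isPath_list (s : Subdivision) : ∀ {I : Interval}, I.left < I.right →
    IsPath I.left (s.list I) I.right := by
  induction s with
  | leaf => exact fun h => ⟨rfl, h, rfl⟩
  | attach s t u hs ht hu =>
    intro I h
    exact (hs (Interval.first_lt h)).append
      ((ht (Interval.middle_lt h)).append (hu (Interval.last_lt h)))

theorem coe_injOn : Set.InjOn ((↑) : ℝ → UnitAddCircle) (Set.Ico (1 / 6) (7 / 6)) := by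
  intro x hx y hy h
  refine (AddCircle.coe_eq_coe_iff_of_mem_Ico (p := (1 : ℝ)) (a := 1 / 6) ?_ ?_).1 h
  · exact ⟨hx.1, by linarith [hx.2]⟩
  · exact ⟨hy.1, by linarith [hy.2]⟩

/-- Two paths of intervals are walked in parallel: the image of the current piece is a piece of `R`
starting where the next piece of `l'` starts, hence is that piece. Since `f` is injective and fixes
the common end `y < 7/6`, neither path can stop before the other. -/
theorem IsPath.forall₂ {f : UnitAddCircle ≃ₜ UnitAddCircle} {R : ArcDiagram} {l : List Interval} :
    ∀ {l' : List Interval} {x x' y : ℝ}, IsPath x l y → IsPath x' l' y →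
    (∀ J ∈ l, ∃ K ∈ R.intervals, MapsLinearly f J K) → (∀ K ∈ l', K ∈ R.intervals) →
    1 / 6 ≤ x → 1 / 6 ≤ x' → y < 7 / 6 → f (x : UnitAddCircle) = (x' : UnitAddCircle) →
    f (y : UnitAddCircle) = (y : UnitAddCircle) → List.Forall₂ (MapsLinearly f) l l' := by
  induction l with
  | nil =>
    intro l' x x' y h h' _ _ hx hx' hy e ey
    obtain rfl : x = y := h
    have : x = x' := coe_injOn ⟨hx, hy⟩ ⟨hx', h'.le.trans_lt hy⟩ (ey.symm.trans e)
    subst this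
    cases l' with
    | nil => exact .nil
    | cons K l' => linarith [h'.1, h'.2.1, h'.2.2.le]
  | cons J l ih =>
    intro l' x x' y h h' hl hl' hx hx' hy e ey
    have hxy : x < y := by linarith [h.1, h.2.1, h.2.2.le]
    cases l' with
    | nil =>
      obtain rfl : x' = y := h'
      exact absurd (coe_injOn ⟨hx, hxy.trans hy⟩ ⟨hx', hy⟩ (f.injective (e.trans ey.symm))) hxy.ne
    | cons K l' =>
      obtain ⟨K', hK', hm⟩ := hl J (List.mem_cons_self ..)
      have : K' = K := R.eq_of_coe_left hK' (hl' K (List.mem_cons_self ..))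
        (by rw [← hm.left, h.1, e, h'.1])
      subst this
      refine .cons hm (ih h.2.2 h'.2.2 (fun J hJ => hl J (List.mem_cons_of_mem _ hJ))
        (fun J hJ => hl' J (List.mem_cons_of_mem _ hJ)) ?_ ?_ hy hm.right ey)
      · linarith [h.1, h.2.1]
      · linarith [h'.1, h'.2.1]

/-! ### Vertices and arcs on the line -/

/-- The vertices strictly inside `I`, from left to right, each with a flag that tells whether it
is the left endpoint of its arc. -/
noncomputable def Subdivision.vertices : Subdivision → Interval → List (ℝ × Bool)
  | .leaf, _ => []
  | .attach s t u, I => s.vertices I.first ++ (I.middle.left, true) ::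
      (t.vertices I.middle ++ (I.middle.right, false) :: u.vertices I.last)

/-- The arcs attached to `I`, as pairs of real numbers. -/
def Subdivision.pairs : Subdivision → Interval → Set (ℝ × ℝ)
  | .leaf, _ => ∅
  | .attach s t u, I => {(I.middle.left, I.middle.right)} ∪
      (s.pairs I.first ∪ t.pairs I.middle ∪ u.pairs I.last)

theorem Subdivision.map_snd_vertices (s : Subdivision) : ∀ I : Interval,
    (s.vertices I).map Prod.snd = s.word := by
  induction s with
  | leaf => exact fun _ => rfl
  | attach s t u hs ht hu => intro I; simp [vertices, word, hs, ht, hu]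

theorem Subdivision.map_left_list (s : Subdivision) : ∀ I : Interval,
    (s.list I).map Interval.left = I.left :: (s.vertices I).map Prod.fst := by
  induction s with
  | leaf => exact fun _ => rfl
  | attach s t u hs ht hu =>
    intro I
    simp only [list, vertices, List.map_append, hs, ht, hu, List.map_cons, List.cons_append]
    rfl

theorem Subdivision.arcs_eq_image (s : Subdivision) : ∀ I : Interval, s.arcs I =
    (fun p : ℝ × ℝ => s((p.1 : UnitAddCircle), (p.2 : UnitAddCircle))) '' s.pairs I := by
  induction s with
  | leaf => intro I; simp [arcs, pairs]
  | attach s t u hs ht hu =>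
    intro I
    simp only [arcs, pairs, Set.image_union, Set.image_singleton, hs, ht, hu]
    rfl

theorem Subdivision.mem_pairs_bounds (s : Subdivision) : ∀ {I : Interval}, I.left < I.right →
    ∀ p ∈ s.pairs I, I.left < p.1 ∧ p.1 < p.2 ∧ p.2 < I.right := by
  induction s with
  | leaf => exact fun _ p hp => hp.elim
  | attach s t u hs ht hu =>
    intro I hI p hp
    rcases hp with hp | (hp | hp) | hp
    · obtain rfl : p = _ := hp
      simp only [Interval.middle]
      refine ⟨?_, ?_, ?_⟩ <;> linarith
    · have := hs (Interval.first_lt hI) p hp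
      simp only [Interval.first] at this
      refine ⟨?_, ?_, ?_⟩ <;> linarith
    · have := ht (Interval.middle_lt hI) p hp
      simp only [Interval.middle] at this
      refine ⟨?_, ?_, ?_⟩ <;> linarith
    · have := hu (Interval.last_lt hI) p hp
      simp only [Interval.last] at this
      refine ⟨?_, ?_, ?_⟩ <;> linarith

theorem Subdivision.mem_vertices_true (s : Subdivision) : ∀ {I : Interval} {v : ℝ},
    (v, true) ∈ s.vertices I ↔ ∃ w, (v, w) ∈ s.pairs I := by
  induction s with
  | leaf => intro I v; simp [vertices, pairs]
  | attach s t u hs ht hu =>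
    intro I v
    simp only [vertices, pairs, List.mem_append, List.mem_cons, hs, ht, hu, Set.mem_union,
      exists_or, Set.mem_singleton_iff, Prod.mk.injEq, exists_and_left, exists_eq, and_true,
      Bool.true_eq_false, and_false, false_or]
    tauto

theorem Subdivision.mem_vertices_false (s : Subdivision) : ∀ {I : Interval} {w : ℝ},
    (w, false) ∈ s.vertices I ↔ ∃ v, (v, w) ∈ s.pairs I := by
  induction s with
  | leaf => intro I v; simp [vertices, pairs]
  | attach s t u hs ht hu =>
    intro I v
    simp only [vertices, pairs, List.mem_append, List.mem_cons, hs, ht, hu, Set.mem_union,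
      exists_or, Set.mem_singleton_iff, Prod.mk.injEq, exists_and_right, exists_eq, true_and,
      Bool.false_eq_true, and_false, false_or, and_true]
    tauto

theorem Subdivision.pairwise_vertices (s : Subdivision) {I : Interval} (hI : I.left < I.right) :
    ((s.vertices I).map Prod.fst).Pairwise (· < ·) := by
  have := (s.isPath_list hI).pairwise
  rw [s.map_left_list] at this
  exact (List.pairwise_cons.1 this).2

theorem Subdivision.vertices_unique (s : Subdivision) {I : Interval} (hI : I.left < I.right)
    {v : ℝ} {b b' : Bool} (h : (v, b) ∈ s.vertices I) (h' : (v, b') ∈ s.vertices I) : b = b' := by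
  have nd : ((s.vertices I).map Prod.fst).Nodup := (s.pairwise_vertices hI).imp fun h => h.ne
  exact (Prod.mk.inj (List.inj_on_of_nodup_map nd h h' rfl)).2

/-- Both ends lie strictly inside `flank`, which excludes `outerArc` and the arcs over the last base
interval. Representatives in `[1/6, 7/6)` are unique, so the arc on the circle determines the pair
of reals. -/
theorem ArcDiagram.mem_pairs_of_mem_arcs {R : ArcDiagram} {p q : ℝ} (hp : 1 / 6 < p) (hpq : p < q)
    (hq : q < 5 / 6) (h : s((p : UnitAddCircle), (q : UnitAddCircle)) ∈ R.arcs) :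
    (p, q) ∈ (Subdivision.attach (R.sub 0) (R.sub 1) (R.sub 2)).pairs flank := by
  have mp : p ∈ Set.Ico (1 / 6 : ℝ) (7 / 6) := ⟨hp.le, by linarith⟩
  have mq : q ∈ Set.Ico (1 / 6 : ℝ) (7 / 6) := ⟨by linarith, by linarith⟩
  rw [arcs_eq_flank, Subdivision.arcs_eq_image, Subdivision.arcs_eq_image] at h
  rcases h with (⟨⟨a, b⟩, hab, e⟩ | e) | ⟨⟨a, b⟩, hab, e⟩
  · obtain ⟨h1, h2, h3⟩ := Subdivision.mem_pairs_bounds _ flank_lt _ hab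
    simp only [flank] at h1 h2 h3
    have ma : a ∈ Set.Ico (1 / 6 : ℝ) (7 / 6) := ⟨h1.le, by linarith⟩
    have mb : b ∈ Set.Ico (1 / 6 : ℝ) (7 / 6) := ⟨by linarith, by linarith⟩
    rcases Sym2.eq_iff.1 e with ⟨e1, e2⟩ | ⟨e1, e2⟩
    · obtain rfl := coe_injOn ma mp e1
      obtain rfl := coe_injOn mb mq e2
      exact hab
    · obtain rfl := coe_injOn ma mq e1
      obtain rfl := coe_injOn mb mp e2
      linarith
  · rcases Sym2.eq_iff.1 (show _ = _ from e) with ⟨e1, e2⟩ | ⟨e1, e2⟩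
    · linarith [coe_injOn mp ⟨le_rfl, by norm_num⟩ e1]
    · linarith [coe_injOn mq ⟨le_rfl, by norm_num⟩ e2]
  · obtain ⟨h1, h2, h3⟩ := Subdivision.mem_pairs_bounds _ (baseInterval_lt 3) _ hab
    have h1 : (5 / 6 : ℝ) < a := h1
    have h3 : b < 7 / 6 := h3
    simp only at h2
    have ma : a ∈ Set.Ico (1 / 6 : ℝ) (7 / 6) := ⟨by linarith, by linarith⟩
    rcases Sym2.eq_iff.1 e with ⟨e1, e2⟩ | ⟨e1, e2⟩
    · linarith [coe_injOn ma mp e1]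
    · linarith [coe_injOn ma mq e1]

theorem lt_of_pairwise_get {α β : Type*} [LinearOrder β] {L : List α} {g : α → β}
    (h : (L.map g).Pairwise (· < ·)) {i j : ℕ} (hi : i < L.length) (hj : j < L.length) :
    g L[i] < g L[j] ↔ i < j := by
  rw [List.pairwise_map, List.pairwise_iff_getElem] at h
  constructor
  · intro hij
    by_contra! hji
    rcases hji.lt_or_eq with hji | rfl
    · exact absurd (h j i hj hi hji) hij.asymm
    · exact lt_irrefl _ hij
  · exact h i j hi hj

/-- A rearrangement of `flank` that carries one subdivision to another preserves their words. -/
theorem word_eq_of_carried {f : UnitAddCircle ≃ₜ UnitAddCircle} {D R : ArcDiagram}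
    (h : Carried f D R) (hf : CarriesInOrder f (.attach (D.sub 0) (D.sub 1) (D.sub 2)) flank
      (.attach (R.sub 0) (R.sub 1) (R.sub 2)) flank) :
    (Subdivision.attach (D.sub 0) (D.sub 1) (D.sub 2)).word =
      (Subdivision.attach (R.sub 0) (R.sub 1) (R.sub 2)).word := by
  have hD : (Subdivision.attach (D.sub 0) (D.sub 1) (D.sub 2)).arcs flank ⊆ D.arcs := by
    rw [arcs_eq_flank, Set.union_assoc]; exact Set.subset_union_left
  have hR : ∀ p q : ℝ, 1 / 6 < p → p < q → q < 5 / 6 →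
      s((p : UnitAddCircle), (q : UnitAddCircle)) ∈ R.arcs →
      (p, q) ∈ (Subdivision.attach (R.sub 0) (R.sub 1) (R.sub 2)).pairs flank :=
    fun p q => mem_pairs_of_mem_arcs
  generalize Subdivision.attach (D.sub 0) (D.sub 1) (D.sub 2) = s at *
  generalize Subdivision.attach (R.sub 0) (R.sub 1) (R.sub 2) = s' at *
  have hv : List.Forall₂ (fun x y : ℝ × Bool => f (x.1 : UnitAddCircle) = (y.1 : UnitAddCircle))
      (s.vertices flank) (s'.vertices flank) := by
    have : List.Forall₂ (fun x y : ℝ => f (x : UnitAddCircle) = (y : UnitAddCircle))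
        ((s.list flank).map Interval.left) ((s'.list flank).map Interval.left) := by
      rw [List.forall₂_map_left_iff, List.forall₂_map_right_iff]
      exact List.Forall₂.imp (fun _ _ h => h.left) hf
    rw [s.map_left_list, s'.map_left_list, List.forall₂_cons, List.forall₂_map_left_iff,
      List.forall₂_map_right_iff] at this
    exact this.2
  have pw := s.pairwise_vertices flank_lt
  have pw' := s'.pairwise_vertices flank_lt
  have uq := fun {v b b'} => s'.vertices_unique flank_lt (v := v) (b := b) (b' := b')
  have bd : ∀ x ∈ s'.vertices flank, 1 / 6 < x.1 ∧ x.1 < 5 / 6 := by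
    rintro ⟨v, b⟩ hx
    cases b with
    | true =>
      obtain ⟨w, hw⟩ := s'.mem_vertices_true.1 hx
      have := s'.mem_pairs_bounds flank_lt _ hw
      simp only [flank] at this
      exact ⟨by linarith, by linarith⟩
    | false =>
      obtain ⟨w, hw⟩ := s'.mem_vertices_false.1 hx
      have := s'.mem_pairs_bounds flank_lt _ hw
      simp only [flank] at this
      exact ⟨by linarith, by linarith⟩
  have mem : ∀ x y, (x, y) ∈ s.pairs flank → ∃ i j, ∃ hi : i < (s.vertices flank).length,
      ∃ hj : j < (s.vertices flank).length, (s.vertices flank)[i] = (x, true) ∧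
        (s.vertices flank)[j] = (y, false) := by
    intro x y hxy
    obtain ⟨i, hi, ei⟩ := List.mem_iff_getElem.1 (s.mem_vertices_true.2 ⟨y, hxy⟩)
    obtain ⟨j, hj, ej⟩ := List.mem_iff_getElem.1 (s.mem_vertices_false.2 ⟨x, hxy⟩)
    exact ⟨i, j, hi, hj, ei, ej⟩
  obtain ⟨hlen, hget⟩ := List.forall₂_iff_get.1 hv
  -- Vertices with equal positions correspond under `f`, and the order of positions is the order on
  -- the line. So the left end of an arc goes to the left end of the image arc, and flags are
  -- preserved.
  have main : ∀ x y, (x, y) ∈ s.pairs flank → ∀ i j (hi : i < (s.vertices flank).length)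
      (hj : j < (s.vertices flank).length) (hi' : i < (s'.vertices flank).length)
      (hj' : j < (s'.vertices flank).length), (s.vertices flank)[i].1 = x →
      (s.vertices flank)[j].1 = y →
      ((s'.vertices flank)[i].1, (s'.vertices flank)[j].1) ∈ s'.pairs flank := by
    intro x y hxy i j hi hj hi' hj' ei ej
    have hlt : i < j := by
      rw [← lt_of_pairwise_get pw hi hj, ei, ej]
      exact (s.mem_pairs_bounds flank_lt _ hxy).2.1
    refine hR _ _ (bd _ (List.getElem_mem _)).1 ((lt_of_pairwise_get pw' hi' hj').2 hlt)
      (bd _ (List.getElem_mem _)).2 ?_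
    have fi := hget i hi hi'
    have fj := hget j hj hj'
    simp only [List.get_eq_getElem] at fi fj
    rw [← fi, ← fj, ← h.arcs, ei, ej]
    refine ⟨s((x : UnitAddCircle), (y : UnitAddCircle)), hD ?_, rfl⟩
    rw [s.arcs_eq_image]
    exact ⟨_, hxy, rfl⟩
  rw [← s.map_snd_vertices flank, ← s'.map_snd_vertices flank]
  refine List.ext_getElem (by simpa using hlen) fun i hi hi' => ?_
  rw [List.length_map] at hi hi'
  rw [List.getElem_map, List.getElem_map]
  obtain ⟨⟨x, b⟩, hx⟩ : ∃ z, (s.vertices flank)[i] = z := ⟨_, rfl⟩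
  have hxm : (x, b) ∈ s.vertices flank := hx ▸ List.getElem_mem _
  have hm : (s'.vertices flank)[i] ∈ s'.vertices flank := List.getElem_mem _
  rw [hx]
  cases b with
  | true =>
    obtain ⟨y, hxy⟩ := s.mem_vertices_true.1 hxm
    obtain ⟨-, j, -, hj, -, ej⟩ := mem x y hxy
    have := main x y hxy i j hi hj hi' (hlen ▸ hj) (by rw [hx]) (by rw [ej])
    exact uq (s'.mem_vertices_true.2 ⟨_, this⟩) hm
  | false =>
    obtain ⟨y, hxy⟩ := s.mem_vertices_false.1 hxm
    obtain ⟨j, -, hj, -, ej, -⟩ := mem y x hxy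
    have := main y x hxy j i hj hi (hlen ▸ hj) hi' (by rw [ej]) (by rw [hx])
    exact uq (s'.mem_vertices_false.2 ⟨_, this⟩) hm

/-- Fixing the last base interval forces `f` to match the pieces of `flank` one by one from left to
right. As arcs also go to arcs, the two parenthesis words agree, and words determine subdivisions up
to rebracketing. -/
theorem rebracket_of_carried {f : UnitAddCircle ≃ₜ UnitAddCircle} {D R : ArcDiagram}
    (hf : MapsLinearly f (baseInterval 3) (baseInterval 3)) (h : Carried f D R) :
    ∃ s s' : Subdivision, s.Rebracket s' ∧ CarriesInOrder f s flank s' flank := by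
  have hl : CarriesInOrder f (.attach (D.sub 0) (D.sub 1) (D.sub 2)) flank
      (.attach (R.sub 0) (R.sub 1) (R.sub 2)) flank := by
    refine IsPath.forall₂ (R := R) (Subdivision.isPath_list _ flank_lt)
      (Subdivision.isPath_list _ flank_lt) (fun J hJ => h.fwd J ?_) (fun K hK => ?_) le_rfl le_rfl
      (by norm_num [flank]) ?_ hf.left
    · rw [intervals_eq_flank]
      exact Or.inl (Subdivision.mem_list _ |>.1 hJ)
    · rw [intervals_eq_flank]
      exact Or.inl (Subdivision.mem_list _ |>.1 hK)
    · have : f ((7 / 6 : ℝ) : UnitAddCircle) = ((7 / 6 : ℝ) : UnitAddCircle) := hf.right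
      rwa [coe_seven_sixths] at this
  exact ⟨_, _, Subdivision.rebracket_of_word (word_eq_of_carried h hl), hl⟩

theorem supportedOn_flank {f : UnitAddCircle → UnitAddCircle}
    (hf : MapsLinearly f (baseInterval 3) (baseInterval 3)) : SupportedOn f flank := by
  intro z hz
  obtain ⟨x, ⟨h1, h2⟩, rfl⟩ : z ∈ ((↑) : ℝ → UnitAddCircle) '' Set.Ioc (1 / 6) (1 / 6 + 1) := by
    rw [AddCircle.coe_image_Ioc_eq]; trivial
  have h3 : 5 / 6 ≤ x := by
    by_contra! h3
    exact hz ⟨x, ⟨h1, h3⟩, rfl⟩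
  have hid : MapsLinearly id (baseInterval 3) (baseInterval 3) := fun _ _ => rfl
  exact hf.eq_of_mem hid (baseInterval_lt 3) h3 (h2.trans (show (1 / 6 + 1 : ℝ) ≤ 7 / 6 by norm_num))

/-! ### Generators and their action on standard intervals -/

/-- The intervals that occur in arc diagrams, and `flank`. -/
inductive Standard : Interval → Prop
  | flank : Standard flank
  | base : Standard (baseInterval 3)
  | first {J} : Standard J → Standard J.first
  | middle {J} : Standard J → Standard J.middle
  | last {J} : Standard J → Standard J.last

theorem Standard.lt {J : Interval} (h : Standard J) : J.left < J.right := by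
  induction h with
  | flank => exact flank_lt
  | base => exact baseInterval_lt 3
  | first _ ih => exact Interval.first_lt ih
  | middle _ ih => exact Interval.middle_lt ih
  | last _ ih => exact Interval.last_lt ih

theorem Standard.le {J : Interval} (h : Standard J) : J.right ≤ J.left + 1 := by
  induction h with
  | flank => norm_num [Basilica.flank]
  | base => simp [baseInterval]; norm_num
  | first h ih => have := h.lt; simp only [Interval.first]; linarith
  | middle h ih => have := h.lt; simp only [Interval.middle]; linarith
  | last h ih => have := h.lt; simp only [Interval.last]; linarith

theorem standard_baseInterval (i : Fin 4) : Standard (baseInterval i) := by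
  fin_cases i
  · exact flank_first ▸ Standard.flank.first
  · exact flank_middle ▸ Standard.flank.middle
  · exact flank_last ▸ Standard.flank.last
  · exact .base

theorem Standard.of_mem_intervals (s : Subdivision) : ∀ {I : Interval}, Standard I →
    ∀ J ∈ s.intervals I, Standard J := by
  induction s with
  | leaf => rintro I h J rfl; exact h
  | attach s t u hs ht hu =>
    rintro I h J ((hJ | hJ) | hJ)
    exacts [hs h.first J hJ, ht h.middle J hJ, hu h.last J hJ]

theorem Standard.of_mem {D : ArcDiagram} {J : Interval} (h : J ∈ D.intervals) : Standard J := by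
  obtain ⟨i, hi⟩ := Set.mem_iUnion.1 h
  exact .of_mem_intervals _ (standard_baseInterval i) J hi

/-- The half turn `r`, the flip `d` and the associator `x` of `flank`. -/
structure Generators (r d x : TB) : Prop where
  r₀ : MapsLinearly r.1 (baseInterval 0) (baseInterval 2)
  r₁ : MapsLinearly r.1 (baseInterval 1) (baseInterval 3)
  r₂ : MapsLinearly r.1 (baseInterval 2) (baseInterval 0)
  r₃ : MapsLinearly r.1 (baseInterval 3) (baseInterval 1)
  d₀ : MapsLinearly d.1 flank (baseInterval 3)
  d₁ : MapsLinearly d.1 (baseInterval 3) flank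
  assoc : IsAssociator x.1 flank

namespace Generators

theorem exists_generators : ∃ r d x : TB, Generators r d x := by
  obtain ⟨r, r₀, r₁, r₂, r₃⟩ := exists_halfTurn
  obtain ⟨d, d₀, d₁⟩ := exists_flip
  obtain ⟨x, hx⟩ := exists_isAssociator flank_lt (A := 1 / 6) le_rfl (by norm_num [flank])
  exact ⟨⟨r, halfTurn_mem r₀ r₁ r₂ r₃⟩, ⟨d, flip_mem d₀ d₁⟩, ⟨x, isAssociator_flank_mem hx⟩,
    ⟨r₀, r₁, r₂, r₃, d₀, d₁, hx⟩⟩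

variable {r d x : TB}

theorem x₁ (h : Generators r d x) : MapsLinearly x.1 (baseInterval 0).first (baseInterval 0) := by
  simpa only [flank_first] using h.assoc.map₁

theorem x₂ (h : Generators r d x) : MapsLinearly x.1 (baseInterval 0).middle (baseInterval 1) := by
  simpa only [flank_first, flank_middle] using h.assoc.map₂

theorem x₃ (h : Generators r d x) :
    MapsLinearly x.1 (baseInterval 0).last (baseInterval 2).first := by
  simpa only [flank_first, flank_last] using h.assoc.map₃

theorem x₄ (h : Generators r d x) :
    MapsLinearly x.1 (baseInterval 1) (baseInterval 2).middle := by
  simpa only [flank_middle, flank_last] using h.assoc.map₄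

theorem x_base (h : Generators r d x) : MapsLinearly x.1 (baseInterval 3) (baseInterval 3) :=
  h.assoc.supp.fix_after (baseInterval_lt 3).le le_rfl (by simp [flank, baseInterval]; norm_num)

theorem d_first (h : Generators r d x) :
    MapsLinearly d.1 (baseInterval 3).first (baseInterval 0) := flank_first ▸ h.d₁.first

theorem d_middle (h : Generators r d x) :
    MapsLinearly d.1 (baseInterval 3).middle (baseInterval 1) := flank_middle ▸ h.d₁.middle

theorem d_last (h : Generators r d x) :
    MapsLinearly d.1 (baseInterval 3).last (baseInterval 2) := flank_last ▸ h.d₁.last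

theorem x_last (h : Generators r d x) :
    MapsLinearly (x * r * x : TB).1 (baseInterval 0).last (baseInterval 0) :=
  (h.x₁.mul h.r₂.first).mul h.x₃

/-- Each standard interval can be moved to the first or to the last base interval by the
generators. -/
theorem exists_move (h : Generators r d x) {H : Subgroup TB} (hr : r ∈ H) (hd : d ∈ H)
    (hx : x ∈ H) {J : Interval} (hJ : Standard J) :
    ∃ g ∈ H, MapsLinearly g.1 J (baseInterval 0) ∨ MapsLinearly g.1 J (baseInterval 3) := by
  induction hJ with
  | flank => exact ⟨d, hd, .inr h.d₀⟩
  | base => exact ⟨1, H.one_mem, .inr (mapsLinearly_one _)⟩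
  | first _ ih =>
    obtain ⟨g, hg, hm | hm⟩ := ih
    · exact ⟨x * g, H.mul_mem hx hg, .inl (h.x₁.mul hm.first)⟩
    · exact ⟨d * g, H.mul_mem hd hg, .inl (h.d_first.mul hm.first)⟩
  | middle _ ih =>
    obtain ⟨g, hg, hm | hm⟩ := ih
    · exact ⟨r * (x * g), H.mul_mem hr (H.mul_mem hx hg), .inr (h.r₁.mul (h.x₂.mul hm.middle))⟩
    · exact ⟨r * (d * g), H.mul_mem hr (H.mul_mem hd hg),
        .inr (h.r₁.mul (h.d_middle.mul hm.middle))⟩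
  | last _ ih =>
    obtain ⟨g, hg, hm | hm⟩ := ih
    · exact ⟨x * r * x * g, H.mul_mem (H.mul_mem (H.mul_mem hx hr) hx) hg,
        .inl (h.x_last.mul hm.last)⟩
    · exact ⟨r * (d * g), H.mul_mem hr (H.mul_mem hd hg), .inl (h.r₂.mul (h.d_last.mul hm.last))⟩

/-- Middle pieces of both base intervals reached by `exists_move` can be sent to the last one, so
passing to `J.middle` removes the alternative there and gives a single target whatever the colour of
`J`. -/
theorem exists_move_middle (h : Generators r d x) {H : Subgroup TB} (hr : r ∈ H) (hd : d ∈ H)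
    (hx : x ∈ H) {J : Interval} (hJ : Standard J) :
    ∃ g ∈ H, MapsLinearly g.1 J.middle (baseInterval 3) := by
  obtain ⟨g, hg, hm | hm⟩ := h.exists_move hr hd hx hJ
  · exact ⟨r * (x * g), H.mul_mem hr (H.mul_mem hx hg), h.r₁.mul (h.x₂.mul hm.middle)⟩
  · exact ⟨r * (d * g), H.mul_mem hr (H.mul_mem hd hg), h.r₁.mul (h.d_middle.mul hm.middle)⟩

/-! ### Computation in the abelianization -/

open Abelianization (of)

/-- Both `x` and the associator of the first base interval are trivial in the abelianization. -/
theorem of_associators (h : Generators r d x) {y : TB} (hy : IsAssociator y.1 (baseInterval 0)) :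
    of y = 1 ∧ of x = 1 := by
  have hy' : IsAssociator y.1 flank.first := flank_first ▸ hy
  have hc : IsAssociator (r * y * r⁻¹ : TB).1 flank.last := by
    rw [flank_last]; exact hy.conj h.r₀ (baseInterval_lt 2)
  have e₁ : x * x = r * y * r⁻¹ * x * y := Subtype.ext
    (h.assoc.pentagon flank_lt (by norm_num [flank]) hy' hc)
  -- The elements `x` and `x * r * x` carry the outer pieces of the first base interval onto the
  -- whole of it, so both smaller associators in the pentagon for `y` are conjugates of `y`.
  have f₁ : IsAssociator (x⁻¹ * y * x⁻¹⁻¹ : TB).1 (baseInterval 0).first :=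
    hy.conj h.x₁.inv (Interval.first_lt (baseInterval_lt 0))
  have f₂ : IsAssociator ((x * r * x)⁻¹ * y * (x * r * x)⁻¹⁻¹ : TB).1 (baseInterval 0).last :=
    hy.conj h.x_last.inv (Interval.last_lt (baseInterval_lt 0))
  have e₂ : y * y = (x * r * x)⁻¹ * y * (x * r * x)⁻¹⁻¹ * y * (x⁻¹ * y * x⁻¹⁻¹) := Subtype.ext
    (hy.pentagon (baseInterval_lt 0) (standard_baseInterval 0).le f₁ f₂)
  have hconj : ∀ g : TB, of (g * y * g⁻¹) = of y := fun g => by simp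
  have g₁ : of x * of x = of y * of x * of y := by
    rw [← map_mul, e₁, map_mul, map_mul, hconj]
  have g₂ : of y * of y = of y * of y * of y := by
    conv_lhs => rw [← map_mul, e₂, map_mul, map_mul, hconj, hconj]
  have hy1 : of y = 1 := by simpa using g₂
  exact ⟨hy1, by simpa [hy1] using g₁⟩

/-- Each standard interval has an associator that is trivial in the abelianization. -/
theorem exists_associator (h : Generators r d x) {J : Interval} (hJ : Standard J) :
    ∃ f : TB, of f = 1 ∧ IsAssociator f.1 J := by
  obtain ⟨y, hy⟩ := exists_isAssociator (baseInterval_lt 0) (A := 1 / 6) le_rfl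
    ((baseInterval_mem 0).2.trans (by norm_num))
  obtain ⟨h1, h2⟩ := h.of_associators (y := ⟨y, isAssociator_base_zero_mem hy⟩) hy
  obtain ⟨g, -, hg | hg⟩ := h.exists_move (H := ⊤) trivial trivial trivial hJ
  · exact ⟨g⁻¹ * ⟨y, isAssociator_base_zero_mem hy⟩ * g⁻¹⁻¹, by simp [h1],
      hy.conj hg.inv hJ.lt⟩
  -- Since `d` carries `flank` to the last base interval, `d * x * d⁻¹` is the associator of the
  -- latter.
  · exact ⟨g⁻¹ * (d * x * d⁻¹) * g⁻¹⁻¹, by simp [h2],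
      (h.assoc.conj h.d₀ (baseInterval_lt 3)).conj hg.inv hJ.lt⟩

/-- A derivation of the rebracketing is translated into a product in the group: each `assoc` becomes
an associator of the standard interval where it takes place, and `attach` becomes a product of three
maps with disjoint open supports. -/
theorem exists_of_rebracket (h : Generators r d x) {s s' : Subdivision} (hs : s.Rebracket s') :
    ∀ {J : Interval}, Standard J →
      ∃ f : TB, of f = 1 ∧ SupportedOn f.1 J ∧ CarriesInOrder f.1 s J s' J := by
  induction hs with
  | refl s =>
    exact fun {J} _ => ⟨1, map_one _, fun _ _ => rfl, (mapsLinearly_one J).carriesInOrder s⟩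
  | symm _ ih =>
    intro J hJ
    obtain ⟨f, h1, h2, h3⟩ := ih hJ
    exact ⟨f⁻¹, by simp [h1], h2.inv, h3.inv⟩
  | trans _ _ ih ih' =>
    intro J hJ
    obtain ⟨f, h1, h2, h3⟩ := ih hJ
    obtain ⟨f', h1', h2', h3'⟩ := ih' hJ
    exact ⟨f' * f, by simp [h1, h1'], h2'.mul h2, h3'.mul h3⟩
  | assoc s t u t' u' =>
    intro J hJ
    obtain ⟨f, h1, h2⟩ := h.exists_associator hJ
    exact ⟨f, h1, h2.supp, h2.carriesInOrder ..⟩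
  | attach _ _ _ ihs iht ihu =>
    intro J hJ
    have lt := hJ.lt
    have le := hJ.le
    obtain ⟨f₁, q₁, s₁, c₁⟩ := ihs hJ.first
    obtain ⟨f₂, q₂, s₂, c₂⟩ := iht hJ.middle
    obtain ⟨f₃, q₃, s₃, c₃⟩ := ihu hJ.last
    have m₁ : MapsLinearly f₁.1 J.middle J.middle := s₁.fix_after hJ.middle.lt.le le_rfl
      (by simp only [Interval.first, Interval.middle]; linarith)
    have l₁ : MapsLinearly f₁.1 J.last J.last := s₁.fix_after hJ.last.lt.le
      (by simp only [Interval.first, Interval.last]; linarith)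
      (by simp only [Interval.first, Interval.last]; linarith)
    have i₂ : MapsLinearly f₂.1 J.first J.first := s₂.fix_before hJ.first.lt.le le_rfl
      (by simp only [Interval.first, Interval.middle]; linarith)
    have l₂ : MapsLinearly f₂.1 J.last J.last := s₂.fix_after hJ.last.lt.le le_rfl
      (by simp only [Interval.last, Interval.middle]; linarith)
    have i₃ : MapsLinearly f₃.1 J.first J.first := s₃.fix_before hJ.first.lt.le
      (by simp only [Interval.first, Interval.last]; linarith)
      (by simp only [Interval.first, Interval.last]; linarith)
    have m₃ : MapsLinearly f₃.1 J.middle J.middle := s₃.fix_before hJ.middle.lt.le le_rfl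
      (by simp only [Interval.last, Interval.middle]; linarith)
    refine ⟨f₃ * f₂ * f₁, by simp [q₁, q₂, q₃], ?_, ?_⟩
    · refine ((s₃.mono (K := J) ?_ le_rfl).mul (s₂.mono (K := J) ?_ ?_)).mul
        (s₁.mono (K := J) le_rfl ?_) <;>
        simp only [Interval.first, Interval.middle, Interval.last] <;> linarith
    · exact (((i₃.carriesInOrder _).attach (m₃.carriesInOrder _) c₃).mul
        ((i₂.carriesInOrder _).attach c₂ (l₂.carriesInOrder _))).mul
        (c₁.attach (m₁.carriesInOrder _) (l₁.carriesInOrder _))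

/-- An element that is the identity on the last base interval is a product of commutators. -/
theorem of_eq_one (h : Generators r d x) {f : TB}
    (hf : MapsLinearly f.1 (baseInterval 3) (baseInterval 3)) : of f = 1 := by
  obtain ⟨D, R, hDR⟩ := (isDyadicRearrangement_iff f.1).1 f.2
  obtain ⟨s, s', hs, hc⟩ := rebracket_of_carried hf hDR
  obtain ⟨g, hg, hg', hc'⟩ := h.exists_of_rebracket hs .flank
  have : f = g := Subtype.ext (hc.eq_of_supportedOn flank_lt hc' (supportedOn_flank hf) hg')
  rw [this, hg]

theorem of_d_sq (h : Generators r d x) : of d * of d = 1 := by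
  rw [← map_mul]
  exact h.of_eq_one (h.d₀.mul h.d₁)

theorem of_x (h : Generators r d x) : of x = 1 := h.of_eq_one h.x_base

/-- Under `r * x` the last base interval returns after three steps, via the second base interval and
the middle of the first. So `(r * x) ^ 3` fixes it, as `r ^ 2` does, and the class of `r` has order
dividing both `3` and `2`. -/
theorem of_r (h : Generators r d x) : of r = 1 := by
  have h2 : of r * of r = 1 := by
    rw [← map_mul]
    exact h.of_eq_one (h.r₁.mul h.r₃)
  have h3 : of (r * x * (r * x) * (r * x)) = 1 :=
    h.of_eq_one (((h.r₁.mul h.x₂).mul (h.r₂.middle.mul h.x₄)).mul (h.r₃.mul h.x_base))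
  simpa [h.of_x, h2] using h3

theorem of_eq (h : Generators r d x) (g : TB) : of g = 1 ∨ of g = of d := by
  have hH : ∀ g : TB, g ∈ (Subgroup.zpowers (of d)).comap of → of g = 1 ∨ of g = of d := by
    intro g hg
    obtain ⟨n, hn⟩ := Subgroup.mem_zpowers_iff.1 (Subgroup.mem_comap.1 hg)
    rcases Int.even_or_odd' n with ⟨k, rfl | rfl⟩
    · left; rw [← hn, zpow_mul, zpow_two, h.of_d_sq, one_zpow]
    · right; rw [← hn, zpow_add_one, zpow_mul, zpow_two, h.of_d_sq, one_zpow, one_mul]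
  apply hH
  obtain ⟨D, R, hDR⟩ := (isDyadicRearrangement_iff g.1).1 g.2
  obtain ⟨J, hJ, -⟩ := (D.sub 0).exists_left (baseInterval 0)
  obtain ⟨K, hK, hm⟩ := hDR.fwd J (mem_intervals 0 hJ)
  -- The preimage of the subgroup generated by `d` contains all three generators, hence also the
  -- elements that move a piece `J.middle` and its image `K.middle` to the last base interval. After
  -- these moves `g` fixes that interval.
  set H := (Subgroup.zpowers (of d)).comap of
  have hr : r ∈ H := Subgroup.mem_comap.2 (h.of_r ▸ Subgroup.one_mem _)
  have hx : x ∈ H := Subgroup.mem_comap.2 (h.of_x ▸ Subgroup.one_mem _)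
  have hd : d ∈ H := Subgroup.mem_comap.2 (Subgroup.mem_zpowers _)
  obtain ⟨g₁, hg₁, m₁⟩ := h.exists_move_middle hr hd hx (.of_mem (mem_intervals 0 hJ))
  obtain ⟨g₂, hg₂, m₂⟩ := h.exists_move_middle hr hd hx (.of_mem hK)
  have : of (g₂ * g * g₁⁻¹) = 1 := h.of_eq_one ((m₂.mul hm.middle).mul m₁.inv)
  have h' : g₂ * g * g₁⁻¹ ∈ H := Subgroup.mem_comap.2 (this ▸ Subgroup.one_mem _)
  exact (H.mul_mem_cancel_left hg₂).1 ((H.mul_mem_cancel_right (H.inv_mem hg₁)).1 h')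

theorem parity_d (h : Generators r d x) : parity d = Multiplicative.ofAdd 1 := by
  -- The exponent is `-1` because the flip maps width `2/3` to width `1/3`.
  have : HasRightSlope d.1 (1 / 6) (-1) :=
    h.d₀.hasRightSlope (by simp [flank, baseInterval]; norm_num) le_rfl flank_lt
  rw [parity_of_hasRightSlope this]
  rfl

end Generators

end Basilica

theorem mainTheorem8 :
    Nonempty (Abelianization Basilica.TB ≃* Multiplicative (ZMod 2)) := by
  obtain ⟨r, d, x, h⟩ := Basilica.Generators.exists_generators
  have hd : Abelianization.lift Basilica.parity (Abelianization.of d) = Multiplicative.ofAdd 1 := by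
    rw [Abelianization.lift_apply_of, h.parity_d]
  refine ⟨MulEquiv.ofBijective (Abelianization.lift Basilica.parity) ⟨?_, ?_⟩⟩
  · rw [injective_iff_map_eq_one]
    intro a ha
    obtain ⟨g, rfl⟩ := QuotientGroup.mk_surjective a
    rcases h.of_eq g with hg | hg
    · exact hg
    · change Abelianization.lift Basilica.parity (Abelianization.of g) = 1 at ha
      rw [hg, hd] at ha
      exact absurd ha (by decide)
  · intro c
    obtain rfl | rfl : c = 1 ∨ c = Multiplicative.ofAdd 1 := by revert c; decide
    · exact ⟨1, map_one _⟩
    · exact ⟨_, hd⟩
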